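/- **Definitions.** Let $w$ be a non-empty string of length $n$ over a finite alphabet. The LZ77 compression of $w$ starts at position $t=1$; at each step it finds the largest $\ell\ge 1$ such that $w_t\cdots w_{t+\ell-1}=w_p\cdots w_{p+\ell-1}$ for some $p<t$ (the two substrings may overlap), emits the symbol $(p,\ell)$ and moves to $t+\ell$; if there is no such $\ell$, it emits the character $w_t$ and moves to $t+1$. The cost $C_{LZ}(w)$ is the total number of emitted symbols. Let $d_\ell(w)$ be the number of distinct substrings of length $\ell$ of $w$ (so $d_\ell(w)=0$ for $\ell>n$). A number $\hat C$ is an $(A,\varepsilon)$-estimate of $C$ if $C/A-\varepsilon n\le\hat C\le A\,C+\varepsilon n$, and a $B$-estimate of $C$ if $C/B\le\hat C\le B\,C$. Let $A>1$ and $\varepsilon>0$ be real numbers with $A\varepsilon<2$, and put $$\ell_0=\Big\lceil\frac{2}{A\varepsilon}\Big\rceil,\qquad B=\frac{A}{2\sqrt{\log_2(2/(A\varepsilon))}},$$ where it is assumed that $B>1$. The algorithm computes, for every $\ell\in\{1,\dots,\ell_0\}$, a random number $\hat d_\ell$ that is a $B$-estimate of $d_\ell(w)$ with probability at least $1-\frac1{3\ell_0}$,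 and outputs $$\hat C_{LZ}=\frac AB\cdot\max_{1\le\ell\le\ell_0}\frac{\hat d_\ell}{\ell}+\varepsilon n .$$ **Theorem.** 1. For every procedure that computes such estimates $\hat d_\ell$ (with an arbitrary joint distribution), the output $\hat C_{LZ}$ is an $(A,\varepsilon)$-estimate of $C_{LZ}(w)$ with probability at least $2/3$. 2. The algorithm has an implementation whose query and time complexity is $\tilde O\big(\frac{n}{A^3\varepsilon}\big)$. Precisely, there are a single program for a randomized real RAM with query access to the input string and constants $K$ and $c$ such that for all $w$, $A$, $\varepsilon$ as above the program, given $n$, the alphabet size, $A$ and $\varepsilon$, always halts after at most $$K\cdot\max(1,g)\cdot\log_2^{\,c}(2+g),\qquad g=\frac{n}{A^3\varepsilon},$$ steps and queries, and outputs $\frac AB\max_{1\le\ell\le\ell_0}\hat d_\ell/\ell+\varepsilon n$, where each $\hat d_\ell$ is a $B$-estimate of $d_\ell(w)$ with probability at least $1-\frac1{3\ell_0}$; the output is an $(A,\varepsilon)$-estimate of $C_{LZ}(w)$ with probability at least $2/3$. If $B\le\sqrt n$, the values $\hat d_\ell$ are a table in the final memory of the machine; if $B>\sqrt n$, they are the trivial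 estimates $\hat d_\ell=\sqrt n$ for $\ell\le n$ and $\hat d_\ell=0$ for $\ell>n$, which need not be stored. Here a randomized real RAM performs in one step: addition or truncated subtraction of natural numbers, reading or writing a memory cell, one query to a position of the string, drawing a uniformly random element of $\{0,\dots,k-1\}$, an arithmetic operation, square root or binary logarithm of real numbers, loading a constant natural number, converting a natural number into a real number, or a comparison or control step. -/

import Mathlib

open scoped ENNReal

/-! ### LZ77 compression -/

/-- A symbol of an LZ77 compressed string: a character of the alphabet, or a pair consisting of a
pointer to an earlier (1-based) position and a length. -/
inductive LZSymbol (α : Type*) where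
  | char (a : α) : LZSymbol α
  | pair (p len : ℕ) : LZSymbol α

/-- With 0-based positions: the substring of `w` of length `len` that starts at `t` lies inside `w`
and is equal to the substring of the same length that starts at the earlier position `p`.
The two substrings may overlap. -/
def LZMatch {α : Type*} (w : List α) (t len p : ℕ) : Prop :=
  p < t ∧ t + len ≤ w.length ∧ (w.drop p).take len = (w.drop t).take len

instance {α : Type*} [DecidableEq α] (w : List α) (t len p : ℕ) : Decidable (LZMatch w t len p) := by
  unfold LZMatch; infer_instance

/-- Length of the longest substring of `w` starting at `t` that also starts at an earlier position
(`0` if the character at `t` has not appeared before). -/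
def lzLongest {α : Type*} [DecidableEq α] (w : List α) (t : ℕ) : ℕ :=
  Nat.findGreatest (fun len => ∃ p < t, LZMatch w t len p) w.length

/-- The part of the compressed string that is produced from position `t` on. (The last occurrence
is taken as the target of a pointer; the number of symbols does not depend on this choice.) -/
def lz77From {α : Type*} [DecidableEq α] (w : List α) (t : ℕ) : List (LZSymbol α) :=
  if h : t < w.length then
    if lzLongest w t = 0 then
      LZSymbol.char w[t] :: lz77From w (t + 1)
    else
      LZSymbol.pair (Nat.findGreatest (fun p => LZMatch w t (lzLongest w t) p) t + 1)
        (lzLongest w t) :: lz77From w (t + lzLongest w t)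
  else []
termination_by w.length - t
decreasing_by all_goals omega

/-- The LZ77 compressed representation of `w`. -/
def lz77 {α : Type*} [DecidableEq α] (w : List α) : List (LZSymbol α) := lz77From w 0

/-- The LZ77 compression cost: the number of symbols of the compressed string. -/
def lzCost {α : Type*} [DecidableEq α] (w : List α) : ℕ := (lz77 w).length

/-- The number `d_ℓ(w)` of distinct substrings of length `ℓ` of `w`. -/
noncomputable def numSubstrings {α : Type*} (w : List α) (l : ℕ) : ℕ :=
  Set.ncard {u : List α | u <:+: w ∧ u.length = l}

/-! ### Estimates and the parameters of the algorithm -/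

/-- `Chat` is a `(lam, ε)`-estimate of `C`, for inputs of length `n`. -/
def IsEstimate (lam ε : ℝ) (n : ℕ) (C Chat : ℝ) : Prop :=
  C / lam - ε * n ≤ Chat ∧ Chat ≤ lam * C + ε * n

/-- `Chat` is a (purely multiplicative) `lam`-estimate of `C`. -/
def IsMulEstimate (lam C Chat : ℝ) : Prop :=
  C / lam ≤ Chat ∧ Chat ≤ lam * C

/-- `ℓ₀ = ⌈2 / (A ε)⌉`. -/
noncomputable def lzEll (A ε : ℝ) : ℕ := ⌈2 / (A * ε)⌉₊

/-- `B = A / (2 √(log₂ (2 / (A ε))))`. -/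
noncomputable def lzB (A ε : ℝ) : ℝ := A / (2 * √(Real.logb 2 (2 / (A * ε))))

/-- The value that the algorithm outputs for strings of length `n` when its estimates of the
numbers `d_ℓ` are `dhat ℓ`: `(A / B) * max_{1 ≤ ℓ ≤ ℓ₀} dhat ℓ / ℓ + ε n`. -/
noncomputable def lzCombine (A ε : ℝ) (n : ℕ) (dhat : ℕ → ℝ) : ℝ :=
  A / lzB A ε * sSup ((fun l : ℕ => dhat l / l) '' Set.Icc 1 (lzEll A ε)) + ε * n

/-! ### The machine model

A randomized real RAM with oracle access to the input string. It has registers and a memory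
for natural numbers (with addition and truncated subtraction only), and registers and a memory for
real numbers (with the arithmetic operations, square root and binary logarithm, but no rounding).
There are no real constants. Memory is addressed by the natural-number registers. -/

/-- The elementary instructions. `x`, `y`, `z` are numbers of registers. -/
inductive RInstr where
  /-- `x := c` -/
  | const (x c : ℕ)
  /-- `x := y + z` -/
  | add (x y z : ℕ)
  /-- `x := y - z` (truncated) -/
  | sub (x y z : ℕ)
  /-- `x := mem[y]` -/
  | load (x y : ℕ)
  /-- `mem[x] := y` -/
  | store (x y : ℕ)
  /-- `x :=` the symbol of the input string at position `y` (counted from `0`) -/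
  | query (x y : ℕ)
  /-- `x :=` a uniformly random element of `{0, …, y - 1}` (and `0` if `y = 0`) -/
  | rand (x y : ℕ)
  /-- real register `x :=` natural-number register `y` -/
  | rofNat (x y : ℕ)
  /-- real `x := y + z` -/
  | radd (x y z : ℕ)
  /-- real `x := y - z` -/
  | rsub (x y z : ℕ)
  /-- real `x := y * z` -/
  | rmul (x y z : ℕ)
  /-- real `x := y / z` -/
  | rdiv (x y z : ℕ)
  /-- real `x := √y` -/
  | rsqrt (x y : ℕ)
  /-- real `x := log₂ y` -/
  | rlog (x y : ℕ)
  /-- real register `x :=` real memory at the address in natural-number register `y` -/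
  | rload (x y : ℕ)
  /-- real memory at the address in natural-number register `x` `:=` real register `y` -/
  | rstore (x y : ℕ)

/-- Tests: comparison of two natural-number registers or of two real registers. -/
inductive RTest where
  | lt (x y : ℕ)
  | rlt (x y : ℕ)

/-- Programs. -/
inductive RProg where
  | instr (i : RInstr)
  | seq (p q : RProg)
  | ite (b : RTest) (p q : RProg)
  | loop (b : RTest) (p : RProg)

/-- The contents of registers and memories, and the number of queries made so far. -/
structure RState where
  reg : ℕ → ℕ
  mem : ℕ → ℕ
  rreg : ℕ → ℝ
  rmem : ℕ → ℝ
  queries : ℕ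

def RTest.holds (s : RState) : RTest → Prop
  | .lt x y => s.reg x < s.reg y
  | .rlt x y => s.rreg x < s.rreg y

/-- The symbol of `w` at position `i`, as a number (`0` outside of the string). -/
def symbolAt {σ : ℕ} (w : List (Fin σ)) (i : ℕ) : ℕ :=
  (w[i]?.map Fin.val).getD 0

/-- The uniform distribution on `{0, …, k - 1}`, and the point mass at `0` if `k = 0`. -/
noncomputable def uniformBelow : ℕ → PMF ℕ
  | 0 => PMF.pure 0
  | k + 1 => (PMF.uniformOfFintype (Fin (k + 1))).map Fin.val

/-- The effect of an elementary instruction on input string `w`. -/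
noncomputable def RInstr.exec {σ : ℕ} (w : List (Fin σ)) (s : RState) : RInstr → PMF RState
  | .const x c => PMF.pure { s with reg := Function.update s.reg x c }
  | .add x y z => PMF.pure { s with reg := Function.update s.reg x (s.reg y + s.reg z) }
  | .sub x y z => PMF.pure { s with reg := Function.update s.reg x (s.reg y - s.reg z) }
  | .load x y => PMF.pure { s with reg := Function.update s.reg x (s.mem (s.reg y)) }
  | .store x y => PMF.pure { s with mem := Function.update s.mem (s.reg x) (s.reg y) }
  | .query x y => PMF.pure { s with
      reg := Function.update s.reg x (symbolAt w (s.reg y))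
      queries := s.queries + 1 }
  | .rand x y => (uniformBelow (s.reg y)).map fun v =>
      { s with reg := Function.update s.reg x v }
  | .rofNat x y => PMF.pure { s with rreg := Function.update s.rreg x (s.reg y : ℝ) }
  | .radd x y z => PMF.pure { s with rreg := Function.update s.rreg x (s.rreg y + s.rreg z) }
  | .rsub x y z => PMF.pure { s with rreg := Function.update s.rreg x (s.rreg y - s.rreg z) }
  | .rmul x y z => PMF.pure { s with rreg := Function.update s.rreg x (s.rreg y * s.rreg z) }
  | .rdiv x y z => PMF.pure { s with rreg := Function.update s.rreg x (s.rreg y / s.rreg z) }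
  | .rsqrt x y => PMF.pure { s with rreg := Function.update s.rreg x (√(s.rreg y)) }
  | .rlog x y => PMF.pure { s with rreg := Function.update s.rreg x (Real.logb 2 (s.rreg y)) }
  | .rload x y => PMF.pure { s with rreg := Function.update s.rreg x (s.rmem (s.reg y)) }
  | .rstore x y => PMF.pure { s with rmem := Function.update s.rmem (s.reg x) (s.rreg y) }

/-- A configuration: the stack of programs that remain to be executed, and the state. The machine
has halted when the stack is empty. -/
structure RConfig where
  todo : List RProg
  state : RState

open Classical in
/-- One computation step on input string `w`. -/
noncomputable def RConfig.step {σ : ℕ} (w : List (Fin σ)) (c : RConfig) : PMF RConfig :=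
  match c.todo with
  | [] => PMF.pure c
  | .instr i :: k => (i.exec w c.state).map fun s => ⟨k, s⟩
  | .seq p q :: k => PMF.pure ⟨p :: q :: k, c.state⟩
  | .ite b p q :: k => PMF.pure ⟨(if b.holds c.state then p else q) :: k, c.state⟩
  | .loop b p :: k =>
      PMF.pure ⟨if b.holds c.state then p :: .loop b p :: k else k, c.state⟩

/-- The distribution of the configuration after `T` steps. -/
noncomputable def RConfig.run {σ : ℕ} (w : List (Fin σ)) : ℕ → RConfig → PMF RConfig
  | 0, c => PMF.pure c
  | T + 1, c => (c.step w).bind (RConfig.run w T)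

/-- The initial configuration of program `P`: the registers contain the length `n` of the string,
the size `σ` of the alphabet, and the parameters `A` and `ε`; everything else is `0`. -/
noncomputable def RProg.init (P : RProg) (n σ : ℕ) (A ε : ℝ) : RConfig where
  todo := [P]
  state :=
    { reg := fun i => if i = 0 then n else if i = 1 then σ else 0
      mem := fun _ => 0
      rreg := fun i => if i = 0 then A else if i = 1 then ε else 0
      rmem := fun _ => 0
      queries := 0 }

/-- The distribution of the configuration that `P` reaches within `T` steps from its initial
configuration, given `A`, `ε` and query access to `w`. -/
noncomputable def RProg.result {σ : ℕ} (P : RProg) (w : List (Fin σ)) (A ε : ℝ) (T : ℕ) :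
    PMF RConfig :=
  (P.init w.length σ A ε).run w T

/-- The estimates of the numbers `d_ℓ` that a run ends with: `d_ℓ` is estimated by the real memory
cell with address `ℓ`. If the approximation parameter `B` exceeds `√n`, then no work is needed for
a `B`-estimate, and the estimate is the trivial one: `√n` (recall `1 ≤ d_ℓ ≤ n` for `ℓ ≤ n`), or `0`
for `ℓ > n`, when there are no substrings of length `ℓ`. -/
noncomputable def RState.dhat (s : RState) (n : ℕ) (B : ℝ) (l : ℕ) : ℝ :=
  if B ≤ √n then s.rmem l else if l ≤ n then √n else 0

/-! ### Windows and first occurrences -/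

/-! The compression cost is controlled from both sides by the ratios `d_ℓ / ℓ`.

Lower bound on the cost (`numSubstrings_le_mul_lzCost`): a substring that lies inside a copied
phrase occurs earlier, so a first occurrence of length `ℓ` must start among the last `ℓ` positions
before the end of some phrase. Hence `d_ℓ ≤ ℓ C`.

Upper bound (`lzCost_le_sum`): by maximality, a phrase extended by one symbol is new. So each
position of a phrase of length at most `i`, up to boundary effects, yields its own first occurrence
of length `2 i`, and these phrases have total length at most `d_{2i} + 2 i`. Summation by parts
turns this into a bound on the number of phrases. If `d_ℓ ≤ m ℓ` for all `ℓ ≤ ⌈x⌉`, the harmonic sum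
gives `C ≤ 4 m log₂ x + 4 n / x`. With `x = 2 / (A ε)` the identity `4 B² log₂ x = A²` makes both
errors fit (`isEstimate_lzCombine`); a union bound over the `ℓ₀` estimates costs probability `1/3`.

Implementation: a single sample of about `(n / B²) log ℓ₀` positions serves all `ℓ`. The substrings
of length at most `ℓ₀` at these positions are kept in a trie, and `d_ℓ` is estimated by `B` times
the number of nodes of depth `ℓ`. This never exceeds `B d_ℓ`; it is large enough once `d_ℓ / B²`
substrings are hit. As long as fewer are hit and `B² ≥ 2`, at least `d_ℓ / 2` positions would bring
a new one, and the supermartingale `potential` bounds the failure probability (`exists_potential`).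
If `B² < 2` all positions are read; if `B > √n` trivial estimates suffice.

On the machine, `Exec` describes deterministic pieces and `Fails` propagates failure bounds
backwards through the program, averaging at random draws. The time is of order `(n / B²) ℓ₀` up to
logarithms; since `(n / B²) x = 8 g log₂ x`, this is `Õ(g)` (`timeBound_le`). -/

/-- The substring of `w` of length `l` that starts at position `j`. -/
def window {α : Type*} (w : List α) (l j : ℕ) : List α := (w.drop j).take l

theorem length_window {α : Type*} (w : List α) {l j : ℕ} (h : j + l ≤ w.length) :
    (window w l j).length = l := by
  simp [window]; omega

theorem window_eq_take_drop {α : Type*} (w : List α) {L o l : ℕ} (j : ℕ) (h : o + l ≤ L) :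
    window w l (j + o) = ((window w L j).drop o).take l := by
  simp only [window, List.drop_take, List.drop_drop, List.take_take]
  congr 1; omega

/-- Used in both directions of the comparison: an earlier copy of a long window carries along
earlier copies of all its parts. -/
theorem window_shift {α : Type*} {w : List α} {L o l i j : ℕ} (h : o + l ≤ L)
    (hij : window w L i = window w L j) : window w l (i + o) = window w l (j + o) := by
  rw [window_eq_take_drop w i h, window_eq_take_drop w j h, hij]

theorem numSubstrings_eq_card_image {α : Type*} [DecidableEq α] (w : List α) (l : ℕ) :
    numSubstrings w l = ((Finset.range (w.length + 1 - l)).image (window w l)).card := by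
  rw [numSubstrings, ← Set.ncard_coe_finset]
  congr 1
  ext u
  simp only [Set.mem_ofPred_eq, Finset.coe_image, Finset.coe_range, Set.mem_image, Set.mem_Iio]
  constructor
  · rintro ⟨⟨s, t, rfl⟩, rfl⟩
    refine ⟨s.length, ?_, ?_⟩
    · simp; omega
    · simp [window]
  · rintro ⟨j, hj, rfl⟩
    exact ⟨(List.take_prefix _ _).isInfix.trans (List.drop_suffix _ _).isInfix,
      length_window w (by omega)⟩

/-- The positions at which a substring of length `l` occurs for the first time. -/
def firstStarts {α : Type*} [DecidableEq α] (w : List α) (l : ℕ) : Finset ℕ :=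
  (Finset.range (w.length + 1 - l)).filter fun j => ∀ i < j, window w l i ≠ window w l j

theorem card_firstStarts {α : Type*} [DecidableEq α] (w : List α) (l : ℕ) :
    (firstStarts w l).card = numSubstrings w l := by
  have hinj : Set.InjOn (window w l) (firstStarts w l) := by
    intro i hi j hj hij
    simp only [firstStarts, Finset.coe_filter, Set.mem_ofPred_eq] at hi hj
    rcases lt_trichotomy i j with h | h | h
    · exact absurd hij (hj.2 i h)
    · exact h
    · exact absurd hij.symm (hi.2 j h)
  rw [numSubstrings_eq_card_image, ← Finset.card_image_of_injOn hinj]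
  congr 1
  apply Finset.Subset.antisymm
  · exact Finset.image_subset_image (Finset.filter_subset _ _)
  · intro u hu
    classical
    simp only [Finset.mem_image, Finset.mem_range] at hu
    have hs := Nat.find_spec hu
    refine Finset.mem_image.2 ⟨Nat.find hu, ?_, hs.2⟩
    simp only [firstStarts, Finset.mem_filter, Finset.mem_range]
    refine ⟨hs.1, fun i hi hw => Nat.find_min hu hi ⟨by omega, hw.trans hs.2⟩⟩

theorem numSubstrings_le_length {α : Type*} [DecidableEq α] (w : List α) {l : ℕ} (hl : 1 ≤ l) :
    numSubstrings w l ≤ w.length := by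
  rw [numSubstrings_eq_card_image]
  refine Finset.card_image_le.trans ?_
  simp; omega

theorem one_le_numSubstrings {α : Type*} [DecidableEq α] (w : List α) {l : ℕ}
    (hl : l ≤ w.length) : 1 ≤ numSubstrings w l := by
  rw [numSubstrings_eq_card_image, Nat.one_le_iff_ne_zero, Finset.card_ne_zero]
  exact ⟨_, Finset.mem_image_of_mem _ (Finset.mem_range.2 (show 0 < _ by omega))⟩

theorem numSubstrings_eq_zero {α : Type*} [DecidableEq α] (w : List α) {l : ℕ}
    (hl : w.length < l) : numSubstrings w l = 0 := by
  rw [numSubstrings_eq_card_image, show w.length + 1 - l = 0 by omega]; simp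

/-! ### The phrases of the LZ77 parsing -/

/-- The length of the part of `w` that the symbol emitted at position `t` stands for. -/
def phraseLen {α : Type*} [DecidableEq α] (w : List α) (t : ℕ) : ℕ := max 1 (lzLongest w t)

theorem one_le_phraseLen {α : Type*} [DecidableEq α] (w : List α) (t : ℕ) :
    1 ≤ phraseLen w t := le_max_left _ _

theorem exists_match {α : Type*} [DecidableEq α] {w : List α} {t : ℕ} (h : lzLongest w t ≠ 0) :
    ∃ p, LZMatch w t (lzLongest w t) p := by
  obtain ⟨p, -, hp⟩ := Nat.findGreatest_of_ne_zero
    (P := fun len => ∃ p < t, LZMatch w t len p) (n := w.length) rfl h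
  exact ⟨p, hp⟩

theorem not_match_of_lt {α : Type*} [DecidableEq α] {w : List α} {t len p : ℕ}
    (h : lzLongest w t < len) : ¬ LZMatch w t len p := fun hm =>
  Nat.findGreatest_is_greatest (P := fun len => ∃ p < t, LZMatch w t len p) h
    (by have := hm.2.1; omega) ⟨p, hm.1, hm⟩

theorem add_phraseLen_le {α : Type*} [DecidableEq α] {w : List α} {t : ℕ} (h : t < w.length) :
    t + phraseLen w t ≤ w.length := by
  rcases eq_or_ne (lzLongest w t) 0 with h0 | h0
  · simp [phraseLen, h0]; omega
  · obtain ⟨p, hp⟩ := exists_match h0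
    have := hp.2.1
    rw [phraseLen]; omega

theorem length_lz77From {α : Type*} [DecidableEq α] {w : List α} {t : ℕ} (h : t < w.length) :
    (lz77From w t).length = (lz77From w (t + phraseLen w t)).length + 1 := by
  rw [lz77From, dif_pos h]
  split_ifs with h0
  · simp [phraseLen, h0]
  · rw [phraseLen, max_eq_right (by omega)]; simp

theorem length_lz77From_of_le {α : Type*} [DecidableEq α] {w : List α} {t : ℕ}
    (h : w.length ≤ t) : (lz77From w t).length = 0 := by
  rw [lz77From, dif_neg (by omega)]; rfl

/-- The lengths of the phrases of the parsing from position `t` on. -/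
def phraseLens {α : Type*} [DecidableEq α] (w : List α) (t : ℕ) : List ℕ :=
  if t < w.length then phraseLen w t :: phraseLens w (t + phraseLen w t) else []
termination_by w.length - t
decreasing_by have := one_le_phraseLen w t; omega

theorem phraseLens_induction {α : Type*} [DecidableEq α] (w : List α) {motive : ℕ → Prop}
    (done : ∀ t, w.length ≤ t → motive t)
    (step : ∀ t, t < w.length → motive (t + phraseLen w t) → motive t) (t : ℕ) : motive t := by
  induction h : w.length - t using Nat.strong_induction_on generalizing t with
  | _ d ih =>
    rcases le_or_gt w.length t with ht | ht
    · exact done t ht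
    · have := one_le_phraseLen w t
      exact step t ht (ih _ (by omega) _ rfl)

theorem phraseLens_of_lt {α : Type*} [DecidableEq α] {w : List α} {t : ℕ} (h : t < w.length) :
    phraseLens w t = phraseLen w t :: phraseLens w (t + phraseLen w t) := by
  rw [phraseLens, if_pos h]

theorem phraseLens_of_le {α : Type*} [DecidableEq α] {w : List α} {t : ℕ} (h : w.length ≤ t) :
    phraseLens w t = [] := by
  rw [phraseLens, if_neg (by omega)]

theorem length_phraseLens {α : Type*} [DecidableEq α] (w : List α) (t : ℕ) :
    (phraseLens w t).length = (lz77From w t).length := by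
  induction t using phraseLens_induction w with
  | done t h => rw [phraseLens_of_le h, length_lz77From_of_le h]; rfl
  | step t h ih => rw [phraseLens_of_lt h, length_lz77From h, List.length_cons, ih]

theorem sum_phraseLens {α : Type*} [DecidableEq α] (w : List α) (t : ℕ) :
    (phraseLens w t).sum = w.length - t := by
  induction t using phraseLens_induction w with
  | done t h => rw [phraseLens_of_le h]; simp; omega
  | step t h ih =>
    have := add_phraseLen_le h
    rw [phraseLens_of_lt h, List.sum_cons, ih]; omega

theorem one_le_of_mem_phraseLens {α : Type*} [DecidableEq α] (w : List α) (t : ℕ) :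
    ∀ k ∈ phraseLens w t, 1 ≤ k := by
  induction t using phraseLens_induction w with
  | done t h => rw [phraseLens_of_le h]; simp
  | step t h ih =>
    rw [phraseLens_of_lt h]
    intro k hk
    rcases List.mem_cons.1 hk with rfl | hk
    · exact one_le_phraseLen w t
    · exact ih k hk

/-! ### The compression cost and the numbers of distinct substrings -/

/-- Induction over the phrases, from the end of the string. A window that starts in a copied phrase
and ends within it also occurs in the source of the copy, so only the last `l` start positions
before the end of the phrase can be first occurrences. -/
theorem card_firstStarts_filter_le {α : Type*} [DecidableEq α] (w : List α) {l : ℕ} (hl : 1 ≤ l)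
    (t : ℕ) : ((firstStarts w l).filter (t ≤ ·)).card ≤ l * (lz77From w t).length := by
  induction t using phraseLens_induction w with
  | done t h =>
    rw [Finset.card_eq_zero.2]; · simp
    ext j
    simp [firstStarts]; omega
  | step t h ih =>
    have hsub : (firstStarts w l).filter (t ≤ ·) ⊆
        (firstStarts w l).filter (t + phraseLen w t ≤ ·) ∪
          Finset.Ico (t + phraseLen w t - l) (t + phraseLen w t) := by
      intro j hj
      simp only [Finset.mem_filter, Finset.mem_union, Finset.mem_Ico] at hj ⊢
      by_cases hjt : t + phraseLen w t ≤ j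
      · exact Or.inl ⟨hj.1, hjt⟩
      refine Or.inr ⟨?_, by omega⟩
      by_contra hlt
      -- A literal phrase has length one, and its only position is among the last `l` since `l ≥ 1`.
      have h0 : lzLongest w t ≠ 0 := fun h0 => by simp [phraseLen, h0] at hlt hjt; omega
      have hk : phraseLen w t = lzLongest w t := by rw [phraseLen]; omega
      obtain ⟨p, hp, hpt, hpw⟩ := exists_match h0
      rw [hk] at hlt
      obtain ⟨o, rfl⟩ := Nat.exists_eq_add_of_le hj.2
      have := window_shift (w := w) (L := lzLongest w t) (o := o) (l := l) (i := p) (j := t)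
        (by omega) hpw
      simp only [firstStarts, Finset.mem_filter] at hj
      exact hj.1.2 (p + o) (by omega) this
    rw [length_lz77From h]
    calc _ ≤ _ := Finset.card_le_card hsub
      _ ≤ _ := Finset.card_union_le _ _
      _ ≤ l * (lz77From w (t + phraseLen w t)).length + l := by
        refine add_le_add ih ?_
        rw [Nat.card_Ico]; omega
      _ = _ := by ring

theorem numSubstrings_le_mul_lzCost {α : Type*} [DecidableEq α] (w : List α) {l : ℕ}
    (hl : 1 ≤ l) : numSubstrings w l ≤ l * lzCost w := by
  have := card_firstStarts_filter_le w hl 0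
  rwa [Finset.filter_true_of_mem (by simp), card_firstStarts] at this

/-- The window of length `2 i` around `j` covers the whole phrase and the symbol after it. An
earlier copy of the window would contain an earlier copy of this extension, against the maximality
of the phrase. -/
theorem mem_firstStarts_of_short {α : Type*} [DecidableEq α] {w : List α} {t i j : ℕ}
    (hk : phraseLen w t ≤ i) (htj : t ≤ j) (hjt : j < t + phraseLen w t)
    (hi : i ≤ j + 1) (hj : j + i < w.length) : j + 1 - i ∈ firstStarts w (2 * i) := by
  simp only [firstStarts, Finset.mem_filter, Finset.mem_range]
  refine ⟨by omega, fun s hs hw => ?_⟩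
  have hle : lzLongest w t ≤ phraseLen w t := le_max_right _ _
  obtain ⟨o, ho⟩ := Nat.exists_eq_add_of_le (show j + 1 - i ≤ t by omega)
  refine not_match_of_lt (w := w) (t := t) (p := s + o) (Nat.lt_succ_self (lzLongest w t))
    ⟨by omega, by omega, ?_⟩
  have := window_shift (o := o) (l := lzLongest w t + 1) (by omega) hw
  rwa [← ho] at this

/-- A phrase length is the number of positions the phrase covers, and different phrases cover
disjoint intervals. The first two alternatives collect the positions whose window of length `2 i`
sticks out of the string. -/
theorem sum_short_le_card {α : Type*} [DecidableEq α] (w : List α) (i t : ℕ) :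
    ((phraseLens w t).filter (· ≤ i)).sum ≤
      ((Finset.Ico t w.length).filter fun j =>
        j + 1 < i ∨ w.length ≤ j + i ∨ j + 1 - i ∈ firstStarts w (2 * i)).card := by
  induction t using phraseLens_induction w with
  | done t h => rw [phraseLens_of_le h]; simp
  | step t h ih =>
    have hk := add_phraseLen_le h
    rw [phraseLens_of_lt h, List.filter_cons,
      ← Finset.Ico_union_Ico_eq_Ico (Nat.le_add_right t (phraseLen w t)) hk,
      Finset.filter_union, Finset.card_union_of_disjoint
        (Finset.disjoint_filter_filter (Finset.Ico_disjoint_Ico_consecutive _ _ _))]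
    split_ifs with hi
    · rw [List.sum_cons]
      refine add_le_add ?_ ih
      rw [Finset.filter_true_of_mem]
      · simp
      · intro j hj
        rw [Finset.mem_Ico] at hj
        by_contra! hc
        exact hc.2.2 (mem_firstStarts_of_short (by simpa using hi) hj.1 hj.2 (by omega) hc.2.1)
    · exact ih.trans (Nat.le_add_left _ _)

theorem sum_short_le {α : Type*} [DecidableEq α] (w : List α) {i : ℕ} (hi : 1 ≤ i) :
    ((phraseLens w 0).filter (· ≤ i)).sum ≤ numSubstrings w (2 * i) + 2 * i := by
  refine (sum_short_le_card w i 0).trans ?_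
  have hsub : ((Finset.Ico 0 w.length).filter fun j =>
      j + 1 < i ∨ w.length ≤ j + i ∨ j + 1 - i ∈ firstStarts w (2 * i)) ⊆
      (firstStarts w (2 * i)).image (fun s => s + i - 1) ∪
        (Finset.range i ∪ Finset.Ico (w.length - i) w.length) := by
    intro j hj
    simp only [Finset.mem_filter, Finset.mem_union, Finset.mem_Ico, Finset.mem_range,
      Finset.mem_image] at hj ⊢
    by_cases h1 : j < i
    · exact Or.inr (Or.inl h1)
    rcases hj.2 with h | h | h
    · omega
    · exact Or.inr (Or.inr (by omega))
    · exact Or.inl ⟨_, h, by omega⟩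
  refine (Finset.card_le_card hsub).trans ((Finset.card_union_le _ _).trans ?_)
  refine add_le_add (Finset.card_image_le.trans (card_firstStarts _ _).le) ?_
  refine (Finset.card_union_le _ _).trans ?_
  simp; omega

/-- Telescoping: `1 / (i (i + 1)) = 1 / i - 1 / (i + 1)`, so for `k ≤ L` the right-hand side is
exactly `1`, and for `k > L` the first summand alone suffices. This is summation by parts for a
single phrase. -/
theorem one_le_div_add_sum {k : ℕ} (hk : 1 ≤ k) (L : ℕ) :
    (1 : ℝ) ≤ k / (L + 1) +
      ∑ i ∈ Finset.Icc 1 L, (if k ≤ i then (k : ℝ) else 0) / (i * (i + 1)) := by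
  have hk' : (1 : ℝ) ≤ k := by exact_mod_cast hk
  induction L with
  | zero => simpa using hk'
  | succ L ih =>
    rw [Finset.sum_Icc_succ_top (by omega)]
    split_ifs with h
    · refine ih.trans (le_of_eq ?_)
      push_cast
      field_simp
      ring
    · have h1 : ((L : ℝ) + 1 + 1) ≤ k := by exact_mod_cast (by omega : L + 1 + 1 ≤ k)
      have h2 : (1 : ℝ) ≤ k / (((L + 1 : ℕ) : ℝ) + 1) := by
        push_cast
        rwa [le_div_iff₀ (by positivity), one_mul]
      have h3 : 0 ≤ ∑ i ∈ Finset.Icc 1 L, (if k ≤ i then (k : ℝ) else 0) / (i * (i + 1)) :=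
        Finset.sum_nonneg fun i _ => by split_ifs <;> positivity
      simp only [zero_div, add_zero]
      linarith

theorem list_length_le_sum (ks : List ℕ) (hks : ∀ k ∈ ks, 1 ≤ k) (L : ℕ) :
    (ks.length : ℝ) ≤ ks.sum / (L + 1) +
      ∑ i ∈ Finset.Icc 1 L, ((ks.filter (· ≤ i)).sum : ℝ) / (i * (i + 1)) := by
  induction ks with
  | nil => simp
  | cons k ks ih =>
    have h1 := one_le_div_add_sum (hks k (by simp)) L
    have h2 := ih fun k hk => hks k (by simp [hk])
    have h3 : ∀ i ∈ Finset.Icc 1 L, (((k :: ks).filter (· ≤ i)).sum : ℝ) / (i * (i + 1)) =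
        (if k ≤ i then (k : ℝ) else 0) / (i * (i + 1)) +
          ((ks.filter (· ≤ i)).sum : ℝ) / (i * (i + 1)) := by
      intro i _
      rw [List.filter_cons, ← add_div]
      by_cases h : k ≤ i <;> simp [h]
    rw [Finset.sum_congr rfl h3, Finset.sum_add_distrib]
    rw [List.length_cons, List.sum_cons, Nat.cast_add, Nat.cast_add, Nat.cast_one, add_div]
    linarith

theorem lzCost_le_sum {α : Type*} [DecidableEq α] (w : List α) (L : ℕ) :
    (lzCost w : ℝ) ≤ w.length / (L + 1) +
      ∑ i ∈ Finset.Icc 1 L, ((numSubstrings w (2 * i) : ℝ) + 2 * i) / (i * (i + 1)) := by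
  have h := list_length_le_sum (phraseLens w 0) (one_le_of_mem_phraseLens w 0) L
  rw [length_phraseLens, sum_phraseLens] at h
  refine h.trans (add_le_add (by simp) (Finset.sum_le_sum fun i hi => ?_))
  have := sum_short_le w (Finset.mem_Icc.1 hi).1
  gcongr
  exact_mod_cast this

theorem lzCost_le_length {α : Type*} [DecidableEq α] (w : List α) : lzCost w ≤ w.length := by
  -- For `L = 0` the sum is empty and the first term is the length.
  have := lzCost_le_sum w 0
  simp at this
  exact this

theorem sum_inv_succ_le_log (L : ℕ) :
    ∑ i ∈ Finset.Icc 1 L, (1 : ℝ) / (i + 1) ≤ Real.log (L + 1) := by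
  induction L with
  | zero => simp
  | succ L ih =>
    rw [Finset.sum_Icc_succ_top (by omega)]
    -- The inequality `1 - 1 / y ≤ log y` at `y = (L + 2) / (L + 1)` gives the increment `1 / (L +
    -- 2)`.
    have h := Real.one_sub_inv_le_log_of_pos (x := ((L : ℝ) + 1 + 1) / (L + 1)) (by positivity)
    rw [Real.log_div (by positivity) (by positivity)] at h
    have h2 : 1 - (((L : ℝ) + 1 + 1) / (L + 1))⁻¹ = 1 / (L + 1 + 1) := by field_simp; ring
    push_cast
    linarith

/-- The hypothesis `1 ≤ m` lets the boundary term `2 i` be absorbed: `d_{2i} + 2 i ≤ 4 m i`, which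
leaves a harmonic sum. -/
theorem lzCost_le_of_numSubstrings_le {α : Type*} [DecidableEq α] {w : List α} {m x : ℝ}
    (hx : 1 < x) (hm : 1 ≤ m)
    (h : ∀ l ∈ Set.Icc 1 ⌈x⌉₊, (numSubstrings w l : ℝ) ≤ m * l) :
    (lzCost w : ℝ) ≤ 4 * m * Real.logb 2 x + 4 * w.length / x := by
  have hlog : Real.log x ≤ Real.logb 2 x := by
    rw [Real.logb, le_div_iff₀ (Real.log_pos one_lt_two)]
    have := Real.log_two_lt_d9
    nlinarith [Real.log_pos hx]
  have hlogpos := Real.log_pos hx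
  -- For small `x` the trivial bound by the length is enough; for `x > 4` the choice `L = ⌈x⌉ / 2`
  -- below keeps `2 L ≤ ⌈x⌉` as well as `L + 1 ≤ x`.
  rcases le_or_gt x 4 with h4 | h4
  · have h1 : (lzCost w : ℝ) ≤ w.length := by exact_mod_cast lzCost_le_length w
    have h2 : (w.length : ℝ) ≤ 4 * w.length / x := by
      rw [le_div_iff₀ (by linarith)]
      nlinarith [(Nat.cast_nonneg w.length : (0 : ℝ) ≤ w.length)]
    have : 0 ≤ 4 * m * Real.logb 2 x := by
      have : 0 ≤ Real.logb 2 x := by linarith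
      positivity
    linarith
  set L := ⌈x⌉₊ / 2 with hL
  have hc1 : x ≤ ⌈x⌉₊ := Nat.le_ceil x
  have hc2 : (⌈x⌉₊ : ℝ) < x + 1 := Nat.ceil_lt_add_one (by linarith)
  have hL1 : x ≤ 2 * ((L : ℝ) + 1) := by
    have : (⌈x⌉₊ : ℝ) ≤ 2 * ((L : ℝ) + 1) := by
      exact_mod_cast (by omega : ⌈x⌉₊ ≤ 2 * (L + 1))
    linarith
  have hL2 : (L : ℝ) + 1 ≤ x := by
    have : (2 : ℝ) * L ≤ ⌈x⌉₊ := by exact_mod_cast (by omega : 2 * L ≤ ⌈x⌉₊)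
    linarith
  refine (lzCost_le_sum w L).trans ?_
  have hsum : ∑ i ∈ Finset.Icc 1 L, ((numSubstrings w (2 * i) : ℝ) + 2 * i) / (i * (i + 1)) ≤
      ∑ i ∈ Finset.Icc 1 L, 4 * m * (1 / ((i : ℝ) + 1)) := by
    refine Finset.sum_le_sum fun i hi => ?_
    rw [Finset.mem_Icc] at hi
    have hd := h (2 * i) ⟨by omega, by omega⟩
    push_cast at hd
    have hi' : (1 : ℝ) ≤ i := by exact_mod_cast hi.1
    rw [mul_one_div, div_le_div_iff₀ (by positivity) (by positivity)]
    have : (numSubstrings w (2 * i) : ℝ) + 2 * i ≤ 4 * m * i := by nlinarith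
    nlinarith
  rw [← Finset.mul_sum] at hsum
  have hh := sum_inv_succ_le_log L
  have hll : Real.log (L + 1) ≤ Real.log x := Real.log_le_log (by positivity) hL2
  have hn : (w.length : ℝ) / (L + 1) ≤ 4 * w.length / x := by
    rw [div_le_div_iff₀ (by positivity) (by linarith)]
    nlinarith [(Nat.cast_nonneg w.length : (0 : ℝ) ≤ w.length)]
  have : 4 * m * ∑ i ∈ Finset.Icc 1 L, (1 : ℝ) / (i + 1) ≤ 4 * m * Real.logb 2 x := by
    gcongr
    linarith
  linarith

/-! ### Correctness of the combination of the estimates -/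

theorem one_lt_two_div {A ε : ℝ} (hA : 1 < A) (hε : 0 < ε) (hAε : A * ε < 2) :
    1 < 2 / (A * ε) := by
  rw [lt_div_iff₀ (by positivity)]; linarith

theorem one_le_lzEll {A ε : ℝ} (hA : 1 < A) (hε : 0 < ε) : 1 ≤ lzEll A ε :=
  Nat.one_le_ceil_iff.2 (by positivity)

theorem finite_div_image (f : ℕ → ℝ) (L : ℕ) :
    ((fun l : ℕ => f l / l) '' Set.Icc 1 L).Finite := (Set.finite_Icc 1 L).image _

theorem isEstimate_lzCombine {α : Type*} [DecidableEq α] {w : List α} {A ε : ℝ} {dhat : ℕ → ℝ}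
    (hw : w ≠ []) (hA : 1 < A) (hε : 0 < ε) (hAε : A * ε < 2) (hB : 1 < lzB A ε)
    (h : ∀ l ∈ Set.Icc 1 (lzEll A ε), IsMulEstimate (lzB A ε) (numSubstrings w l) (dhat l)) :
    IsEstimate A ε w.length (lzCost w) (lzCombine A ε w.length dhat) := by
  set B := lzB A ε with hBdef
  set M := sSup ((fun l : ℕ => dhat l / l) '' Set.Icc 1 (lzEll A ε)) with hM
  have hB0 : 0 < B := by linarith
  have hA0 : 0 < A := by linarith
  have hx := one_lt_two_div hA hε hAε
  have hfin := finite_div_image dhat (lzEll A ε)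
  have hle : ∀ l ∈ Set.Icc 1 (lzEll A ε), dhat l / l ≤ M := fun l hl =>
    le_csSup hfin.bddAbove (Set.mem_image_of_mem _ hl)
  have hne : ((fun l : ℕ => dhat l / l) '' Set.Icc 1 (lzEll A ε)).Nonempty :=
    ⟨_, Set.mem_image_of_mem _ ⟨le_rfl, one_le_lzEll hA hε⟩⟩
  have hn : 1 ≤ w.length := List.length_pos_of_ne_nil hw
  have hd1 : 1 ≤ numSubstrings w 1 := one_le_numSubstrings w hn
  have hdl : ∀ l ∈ Set.Icc 1 (lzEll A ε), (numSubstrings w l : ℝ) ≤ M * B * l := by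
    intro l hl
    have h1 := (h l hl).1
    have h2 := hle l hl
    have hl0 : (0 : ℝ) < l := by exact_mod_cast hl.1
    rw [div_le_iff₀ hl0] at h2
    rw [div_le_iff₀ hB0] at h1
    nlinarith
  -- The case `l = 1`: a non-empty string has at least one symbol.
  have hMB : 1 ≤ M * B := by
    have := hdl 1 ⟨le_rfl, one_le_lzEll hA hε⟩
    have h1 : (1 : ℝ) ≤ numSubstrings w 1 := by exact_mod_cast hd1
    push_cast at this
    linarith
  -- This identity is the reason for the choice of `B`: it balances the factor `4 B log₂ x` of the
  -- upper bound on the cost against `A² / B`.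
  have hBsq : B ^ 2 * (4 * Real.logb 2 (2 / (A * ε))) = A ^ 2 := by
    have hlog : 0 < Real.logb 2 (2 / (A * ε)) := Real.logb_pos one_lt_two hx
    have hs := Real.sqrt_pos.2 hlog
    rw [hBdef, lzB, div_pow, mul_pow, Real.sq_sqrt hlog.le]
    field_simp
    norm_num
  have hcost := lzCost_le_of_numSubstrings_le (w := w) hx hMB hdl
  constructor
  · have e1 : 4 * (M * B) * Real.logb 2 (2 / (A * ε)) = A ^ 2 * M / B := by
      rw [← hBsq]; field_simp
    -- After division by `A` the additive error is `2 ε n`: one half is the term added to the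
    -- output, the other half is the tolerance of the estimate.
    have e2 : 4 * (w.length : ℝ) / (2 / (A * ε)) = 2 * A * ε * w.length := by
      field_simp; ring
    rw [e1, e2] at hcost
    rw [lzCombine, sub_le_iff_le_add, div_le_iff₀ hA0]
    calc (lzCost w : ℝ) ≤ _ := hcost
      _ = _ := by rw [← hM, ← hBdef]; field_simp; ring
  · have hMle : M ≤ B * lzCost w := by
      refine csSup_le hne ?_
      rintro _ ⟨l, hl, rfl⟩
      have hl0 : (0 : ℝ) < l := by exact_mod_cast hl.1
      have h1 := (h l hl).2
      have h2 : (numSubstrings w l : ℝ) ≤ l * lzCost w := by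
        exact_mod_cast numSubstrings_le_mul_lzCost w hl.1
      simp only
      rw [div_le_iff₀ hl0]
      nlinarith
    rw [lzCombine, ← hM, ← hBdef]
    have : A / B * M ≤ A * lzCost w := by
      calc A / B * M ≤ A / B * (B * lzCost w) := by gcongr
        _ = _ := by field_simp
    linarith

theorem isEstimate_lzCombine_of_probability {α : Type*} [DecidableEq α] {w : List α} {A ε : ℝ}
    (hw : w ≠ []) (hA : 1 < A) (hε : 0 < ε) (hAε : A * ε < 2) (hB : 1 < lzB A ε)
    {Ω : Type*} [MeasurableSpace Ω] (μ : MeasureTheory.Measure Ω)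
    [MeasureTheory.IsProbabilityMeasure μ] (dhat : Ω → ℕ → ℝ)
    (hmeas : ∀ l ∈ Set.Icc 1 (lzEll A ε), Measurable fun ω => dhat ω l)
    (hprob : ∀ l ∈ Set.Icc 1 (lzEll A ε),
      1 - 1 / (3 * (lzEll A ε : ℝ)) ≤
        μ.real {ω | IsMulEstimate (lzB A ε) (numSubstrings w l) (dhat ω l)}) :
    2 / 3 ≤ μ.real {ω | IsEstimate A ε w.length (lzCost w)
      (lzCombine A ε w.length (dhat ω))} := by
  set G : ℕ → Set Ω := fun l => {ω | IsMulEstimate (lzB A ε) (numSubstrings w l) (dhat ω l)}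
  have hG : ∀ l ∈ Finset.Icc 1 (lzEll A ε), MeasurableSet (G l) := by
    intro l hl
    have := hmeas l (by simpa using hl)
    exact (measurableSet_le measurable_const this).inter (measurableSet_le this measurable_const)
  have hbad : ∀ l ∈ Finset.Icc 1 (lzEll A ε), μ.real (G l)ᶜ ≤ 1 / (3 * (lzEll A ε : ℝ)) := by
    intro l hl
    rw [MeasureTheory.probReal_compl_eq_one_sub (hG l hl)]
    linarith [hprob l (by simpa using hl)]
  have hinter : MeasurableSet (⋂ l ∈ Finset.Icc 1 (lzEll A ε), G l) :=
    Finset.measurableSet_biInter _ hG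
  have hU : μ.real (⋂ l ∈ Finset.Icc 1 (lzEll A ε), G l)ᶜ ≤ 1 / 3 := by
    rw [Set.compl_iInter₂]
    refine (MeasureTheory.measureReal_biUnion_finset_le _ _).trans
      ((Finset.sum_le_sum hbad).trans (le_of_eq ?_))
    have : (lzEll A ε : ℝ) ≠ 0 := by
      have := one_le_lzEll hA hε; positivity
    simp
    field_simp
  rw [MeasureTheory.probReal_compl_eq_one_sub hinter] at hU
  calc (2 / 3 : ℝ) ≤ μ.real (⋂ l ∈ Finset.Icc 1 (lzEll A ε), G l) := by linarith
    _ ≤ _ := MeasureTheory.measureReal_mono fun ω hω =>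
      isEstimate_lzCombine hw hA hε hAε hB fun l hl =>
        Set.mem_iInter₂.1 hω l (by simpa using hl)

/-! ### Sampling positions -/

/-- The non-empty substrings of length at most `L` that start at the positions in `ps`. -/
def sampled {α : Type*} [DecidableEq α] (w : List α) (L : ℕ) (ps : Finset ℕ) :
    Finset (List α) :=
  ps.biUnion fun p => (Finset.Icc 1 (min L (w.length - p))).image fun l => window w l p

/-- The number of distinct substrings of length `l` that start at the positions in `ps`. -/
def hits {α : Type*} [DecidableEq α] (w : List α) (L l : ℕ) (ps : Finset ℕ) : ℕ :=
  ((sampled w L ps).filter fun u => u.length = l).card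

theorem hits_eq_card_image {α : Type*} [DecidableEq α] (w : List α) {L l : ℕ} (hl : 1 ≤ l)
    (hL : l ≤ L) (ps : Finset ℕ) :
    hits w L l ps = ((ps.filter fun p => p + l ≤ w.length).image (window w l)).card := by
  rw [hits]
  congr 1
  ext u
  simp only [sampled, Finset.mem_filter, Finset.mem_biUnion, Finset.mem_image, Finset.mem_Icc]
  constructor
  · rintro ⟨⟨p, hp, k, ⟨hk1, hk⟩, rfl⟩, hu⟩
    rw [length_window w (by omega)] at hu
    subst hu
    exact ⟨p, ⟨hp, by omega⟩, rfl⟩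
  · rintro ⟨p, ⟨hp, hpl⟩, rfl⟩
    exact ⟨⟨p, hp, l, ⟨hl, by omega⟩, rfl⟩, length_window w hpl⟩

theorem hits_mono {α : Type*} [DecidableEq α] (w : List α) (L l : ℕ) {ps qs : Finset ℕ}
    (h : ps ⊆ qs) : hits w L l ps ≤ hits w L l qs :=
  Finset.card_le_card
    (Finset.filter_subset_filter _ (Finset.biUnion_subset_biUnion_of_subset_left _ h))

theorem hits_le_numSubstrings {α : Type*} [DecidableEq α] (w : List α) {L l : ℕ} (hl : 1 ≤ l)
    (hL : l ≤ L) (ps : Finset ℕ) : hits w L l ps ≤ numSubstrings w l := by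
  rw [hits_eq_card_image w hl hL, numSubstrings_eq_card_image]
  refine Finset.card_le_card (Finset.image_subset_image fun p hp => ?_)
  simp only [Finset.mem_filter, Finset.mem_range] at hp ⊢
  omega

theorem hits_eq_numSubstrings {α : Type*} [DecidableEq α] (w : List α) {L l : ℕ} (hl : 1 ≤ l)
    (hL : l ≤ L) {ps : Finset ℕ} (hps : Finset.range w.length ⊆ ps) :
    hits w L l ps = numSubstrings w l := by
  refine le_antisymm (hits_le_numSubstrings w hl hL ps) ?_
  rw [hits_eq_card_image w hl hL, numSubstrings_eq_card_image]
  refine Finset.card_le_card (Finset.image_subset_image fun p hp => ?_)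
  simp only [Finset.mem_filter, Finset.mem_range] at hp ⊢
  exact ⟨hps (Finset.mem_range.2 (by omega)), by omega⟩

theorem one_le_hits {α : Type*} [DecidableEq α] (w : List α) {L l : ℕ} (hl : 1 ≤ l)
    (hL : l ≤ L) (hlw : l ≤ w.length) {ps : Finset ℕ} (hps : 0 ∈ ps) : 1 ≤ hits w L l ps := by
  rw [hits_eq_card_image w hl hL, Nat.one_le_iff_ne_zero, Finset.card_ne_zero]
  exact ⟨_, Finset.mem_image_of_mem _ (Finset.mem_filter.2 ⟨hps, by omega⟩)⟩

/-- Each substring that has not been hit starts at some position, and choosing this position would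
hit it; distinct substrings need distinct positions. -/
theorem numSubstrings_le_hits_add {α : Type*} [DecidableEq α] (w : List α) {L l : ℕ}
    (hl : 1 ≤ l) (hL : l ≤ L) (ps : Finset ℕ) :
    numSubstrings w l ≤ hits w L l ps +
      (Finset.univ.filter fun j : Fin w.length =>
        hits w L l ps < hits w L l (insert (j : ℕ) ps)).card := by
  set I := (ps.filter fun p => p + l ≤ w.length).image (window w l) with hI
  have hsub : (Finset.range (w.length + 1 - l)).image (window w l) ⊆
      I ∪ (Finset.univ.filter fun j : Fin w.length =>
        hits w L l ps < hits w L l (insert (j : ℕ) ps)).image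
          fun j : Fin w.length => window w l j := by
    intro u hu
    simp only [Finset.mem_image, Finset.mem_range] at hu
    obtain ⟨j, hj, rfl⟩ := hu
    by_cases hmem : window w l j ∈ I
    · exact Finset.mem_union_left _ hmem
    · refine Finset.mem_union_right _ (Finset.mem_image.2 ⟨⟨j, by omega⟩, ?_, rfl⟩)
      simp only [Finset.mem_filter, Finset.mem_univ, true_and]
      rw [hits_eq_card_image w hl hL, hits_eq_card_image w hl hL, Finset.filter_insert,
        if_pos (by omega), Finset.image_insert, ← hI, Finset.card_insert_of_notMem hmem]
      exact Nat.lt_succ_self _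
  rw [numSubstrings_eq_card_image]
  exact (Finset.card_le_card hsub).trans ((Finset.card_union_le _ _).trans
    (add_le_add (hits_eq_card_image w hl hL ps).ge Finset.card_image_le))

/-- A supermartingale that bounds the probability that fewer than `m` substrings are hit when
`r` further samples are drawn. -/
noncomputable def potential (m : ℕ) (q : ℝ) (X r : ℕ) : ℝ :=
  if m ≤ X then 0 else 2 ^ (m - X) * (1 - q) ^ r

theorem potential_nonneg (m : ℕ) {q : ℝ} (hq : q ≤ 1) (X r : ℕ) : 0 ≤ potential m q X r := by
  have : 0 ≤ 1 - q := by linarith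
  rw [potential]; split_ifs <;> positivity

theorem potential_anti (m : ℕ) {q : ℝ} (hq : q ≤ 1) {X Y : ℕ} (h : X ≤ Y) (r : ℕ) :
    potential m q Y r ≤ potential m q X r := by
  rcases le_or_gt m Y with hY | hY
  · rw [potential, if_pos hY]; exact potential_nonneg m hq X r
  · have : 0 ≤ 1 - q := by linarith
    rw [potential, potential, if_neg (by omega), if_neg (by omega)]
    gcongr
    exact one_le_two

/-- One more hit removes a factor two, or reaches the target `m` and makes the potential vanish. -/
theorem potential_of_lt_le_half (m : ℕ) {q : ℝ} (hq : q ≤ 1) {X Y : ℕ} (h : X < Y) (r : ℕ) :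
    potential m q Y r ≤ potential m q X r / 2 := by
  refine (potential_anti m hq (Nat.succ_le_of_lt h) r).trans ?_
  rcases le_or_gt m X.succ with hX | hX
  · rw [potential, if_pos hX]
    have := potential_nonneg m hq X r
    linarith
  · rw [potential, potential, if_neg (by omega), if_neg (by omega),
      show m - X = (m - X.succ) + 1 by omega, pow_succ]
    exact le_of_eq (by ring)

/-- With probability at least `2 q` the potential is halved, and otherwise it does not grow, so on
average it shrinks by the factor `1 - q`. -/
theorem average_potential_le {n m : ℕ} (hn : 0 < n) {q : ℝ} (hq1 : q ≤ 1) (X r : ℕ)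
    (Y : Fin n → ℕ) (hY : ∀ j, X ≤ Y j)
    (hnew : X < m → 2 * q * n ≤ (Finset.univ.filter fun j => X < Y j).card) :
    (∑ j, potential m q (Y j) r) / n ≤ potential m q X (r + 1) := by
  have hn' : (0 : ℝ) < n := by exact_mod_cast hn
  rcases le_or_gt m X with hX | hX
  · have h0 : ∀ j, potential m q (Y j) r = 0 := fun j => by
      rw [potential, if_pos (hX.trans (hY j))]
    simp only [h0, Finset.sum_const_zero, zero_div]
    exact potential_nonneg m hq1 _ _
  have hle : ∀ j, potential m q (Y j) r ≤
      potential m q X r - if X < Y j then potential m q X r / 2 else 0 := by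
    intro j
    split_ifs with h
    · linarith [potential_of_lt_le_half m hq1 h r]
    · linarith [potential_anti m hq1 (hY j) r]
  have hs : potential m q X (r + 1) = potential m q X r * (1 - q) := by
    rw [potential, potential, if_neg (by omega), if_neg (by omega), pow_succ]; ring
  rw [div_le_iff₀ hn', hs]
  refine (Finset.sum_le_sum fun j _ => hle j).trans ?_
  rw [Finset.sum_sub_distrib, ← Finset.sum_filter, Finset.sum_const, Finset.sum_const,
    Finset.card_univ, Fintype.card_fin, nsmul_eq_mul, nsmul_eq_mul]
  have h0 := potential_nonneg m hq1 X r
  nlinarith [hnew hX]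

/-- The number of iterations of the sampling loop (before rounding up). -/
noncomputable def sampleBound (B : ℝ) (n L : ℕ) : ℝ :=
  if B * B < 2 then n else n / (B * B) * 4 * (Real.logb 2 (3 * L) + 1)

open Classical in
/-- The position that is chosen in round `i` when the random number is `j`: if `B` is small, then
all positions are read. -/
noncomputable def chosen (B : ℝ) (i j : ℕ) : ℕ := if B * B < 2 then i else j

/-- With `y = D / B²`, the initial power of two is at most `exp y`. The `N` rounds contribute at
most `exp (-y (log₂ (3 L) + 1))`, whose summand `1` cancels that factor; `y > 1` does the rest. -/
theorem potential_zero_le {n D L N m : ℕ} {B : ℝ} (hn : 0 < n) (hD : D ≤ n) (hL : 1 ≤ L)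
    (hB : 2 ≤ B * B) (hm : m = ⌈(D : ℝ) / (B * B)⌉₊) {X : ℕ} (hX : 1 ≤ X)
    (hN : (n : ℝ) / (B * B) * 4 * (Real.logb 2 (3 * L) + 1) ≤ N) :
    potential m (D / (4 * n)) X N ≤ 1 / (3 * (L : ℝ)) := by
  have hL' : (1 : ℝ) ≤ L := by exact_mod_cast hL
  have hn' : (0 : ℝ) < n := by exact_mod_cast hn
  have hD' : (D : ℝ) ≤ n := by exact_mod_cast hD
  have hB0 : 0 < B * B := by linarith
  rw [potential]
  split_ifs with h
  · positivity
  -- Having one hit at the start is what removes the rounding: `m - X ≤ m - 1 < D / B²`.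
  have hmy : ((m - X : ℕ) : ℝ) ≤ D / (B * B) := by
    have : m - X < m := by omega
    rw [hm] at this ⊢
    exact (Nat.lt_ceil.1 this).le
  have hy1 : 1 < (D : ℝ) / (B * B) := by
    have : 1 < m := by omega
    rw [hm] at this
    exact_mod_cast Nat.lt_ceil.1 this
  set y := (D : ℝ) / (B * B) with hy
  have hlog : 0 ≤ Real.log (3 * L) := Real.log_nonneg (by linarith)
  have hlogb : Real.log (3 * L) ≤ Real.logb 2 (3 * L) := by
    rw [Real.logb, le_div_iff₀ (Real.log_pos one_lt_two)]
    have := Real.log_two_lt_d9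
    nlinarith
  have h1 : (2 : ℝ) ^ (m - X) ≤ Real.exp y := by
    calc (2 : ℝ) ^ (m - X) ≤ Real.exp 1 ^ (m - X) := by
          gcongr; have := Real.add_one_le_exp 1; linarith
      _ = Real.exp ((m - X : ℕ) : ℝ) := by rw [← Real.exp_nat_mul, mul_one]
      _ ≤ _ := Real.exp_le_exp.2 hmy
  have hq : (D : ℝ) / (4 * n) ≤ 1 := by
    rw [div_le_one (by positivity)]; linarith
  have h2 : (1 - (D : ℝ) / (4 * n)) ^ N ≤ Real.exp (-(y * (Real.logb 2 (3 * L) + 1))) := by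
    calc (1 - (D : ℝ) / (4 * n)) ^ N ≤ Real.exp (-(D / (4 * n))) ^ N := by
          gcongr
          have := Real.add_one_le_exp (-((D : ℝ) / (4 * n))); linarith
      _ = Real.exp (N * -(D / (4 * n))) := by rw [← Real.exp_nat_mul]
      _ ≤ _ := by
        refine Real.exp_le_exp.2 ?_
        have h3 : y * (Real.logb 2 (3 * L) + 1) =
            (n : ℝ) / (B * B) * 4 * (Real.logb 2 (3 * L) + 1) * (D / (4 * n)) := by
          rw [hy]; field_simp
        rw [h3, mul_neg]
        gcongr
  calc (2 : ℝ) ^ (m - X) * (1 - (D : ℝ) / (4 * n)) ^ N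
      ≤ Real.exp y * Real.exp (-(y * (Real.logb 2 (3 * L) + 1))) := by
        gcongr
    _ = Real.exp (-(y * Real.logb 2 (3 * L))) := by rw [← Real.exp_add]; congr 1; ring
    _ ≤ Real.exp (-Real.log (3 * L)) := Real.exp_le_exp.2 (by nlinarith)
    _ = 1 / (3 * L) := by
        rw [Real.exp_neg, Real.exp_log (by positivity), one_div]

/-- This is all that the analysis of the machine needs to know about sampling: a nonnegative
function that does not grow on average, is at least `1` at bad final samples, and starts at the
permitted failure probability. -/
theorem exists_potential {α : Type*} [DecidableEq α] {w : List α} (hw : w ≠ []) {L l : ℕ}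
    (hl : 1 ≤ l) (hL : l ≤ L) {B : ℝ} (hB : 1 < B) :
    ∃ Φ : ℕ → Finset ℕ → ℝ, (∀ i ps, 0 ≤ Φ i ps) ∧
      (∀ i ps, i < ⌈sampleBound B w.length L⌉₊ →
        (∑ j : Fin w.length, Φ (i + 1) (insert (chosen B i j) ps)) / w.length ≤ Φ i ps) ∧
      (∀ ps, ¬ IsMulEstimate B (numSubstrings w l) (hits w L l ps * B) →
        1 ≤ Φ ⌈sampleBound B w.length L⌉₊ ps) ∧
      Φ 0 {0} ≤ 1 / (3 * (L : ℝ)) := by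
  have hn : 0 < w.length := List.length_pos_of_ne_nil hw
  have hn' : (0 : ℝ) < w.length := by exact_mod_cast hn
  have hB0 : 0 < B := by linarith
  have hup : ∀ ps, (hits w L l ps : ℝ) * B ≤ B * numSubstrings w l := fun ps => by
    rw [mul_comm]
    have := hits_le_numSubstrings w hl hL ps
    gcongr
  have hL0 : (0 : ℝ) < L := by exact_mod_cast hl.trans hL
  have hDn := numSubstrings_le_length w hl
  by_cases hdet : B * B < 2
  · refine ⟨fun i ps => if Finset.range i ⊆ ps then 0 else 1, ?_, ?_, ?_, ?_⟩
    · intro i ps; dsimp only; split_ifs <;> norm_num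
    · intro i ps _
      simp only [chosen, if_pos hdet, Finset.sum_const, Finset.card_univ, Fintype.card_fin,
        nsmul_eq_mul]
      rw [mul_div_cancel_left₀ _ hn'.ne']
      by_cases h : Finset.range i ⊆ ps
      · rw [if_pos, if_pos h]
        rw [Finset.range_add_one]
        exact Finset.insert_subset_insert _ h
      · rw [if_neg h]; split_ifs <;> norm_num
    · intro ps hbad
      simp only [sampleBound, if_pos hdet, Nat.ceil_natCast]
      rw [if_neg]
      intro hps
      refine hbad ⟨?_, hup ps⟩
      rw [hits_eq_numSubstrings w hl hL hps, div_le_iff₀ hB0]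
      have : (0 : ℝ) ≤ numSubstrings w l := Nat.cast_nonneg _
      have h1 : 1 ≤ B * B := by nlinarith
      nlinarith
    · simp only [Finset.range_zero, Finset.empty_subset, if_true]; positivity
  · set D := numSubstrings w l with hD
    set m := ⌈(D : ℝ) / (B * B)⌉₊ with hm
    set N := ⌈sampleBound B w.length L⌉₊ with hN
    have hD' : (D : ℝ) ≤ w.length := by exact_mod_cast hDn
    have hq : (D : ℝ) / (4 * w.length) ≤ 1 := by
      rw [div_le_one (by positivity)]; linarith
    refine ⟨fun i ps => potential m (D / (4 * w.length)) (hits w L l ps) (N - i),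
      fun i ps => potential_nonneg _ hq _ _, ?_, ?_, ?_⟩
    · intro i ps hi
      simp only [chosen, if_neg hdet]
      have e : N - i = N - (i + 1) + 1 := by omega
      rw [e]
      refine average_potential_le hn hq _ _ _
        (fun j => hits_mono w L l (Finset.subset_insert _ _)) fun hX => ?_
      -- Below the target fewer than `D / B² ≤ D / 2` substrings are hit, so at least `D / 2 = 2 q
      -- n` positions bring a new one.
      have h1 : (hits w L l ps : ℝ) < D / (B * B) := Nat.lt_ceil.1 hX
      have h2 : (D : ℝ) / (B * B) ≤ D / 2 := by
        gcongr; linarith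
      have h3 : (D : ℝ) ≤ hits w L l ps + ((Finset.univ.filter fun j : Fin w.length =>
          hits w L l ps < hits w L l (insert (j : ℕ) ps)).card : ℝ) := by
        exact_mod_cast numSubstrings_le_hits_add w hl hL ps
      have h4 : 2 * ((D : ℝ) / (4 * w.length)) * w.length = D / 2 := by
        field_simp; ring
      rw [h4]
      linarith
    · intro ps hbad
      have hlt : ¬ m ≤ hits w L l ps := by
        intro hle
        refine hbad ⟨?_, hup ps⟩
        have := Nat.ceil_le.1 hle
        rw [div_le_iff₀ (by positivity)] at this
        rw [div_le_iff₀ hB0]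
        linarith
      dsimp only
      rw [potential, if_neg hlt, Nat.sub_self, pow_zero, mul_one]
      exact one_le_pow₀ one_le_two
    · dsimp only
      rw [Nat.sub_zero]
      rcases le_or_gt l w.length with h | h
      · refine potential_zero_le hn hDn (hl.trans hL) (not_lt.1 hdet) hm
          (one_le_hits w hl hL h (by simp)) ?_
        rw [hN, sampleBound, if_neg hdet]
        exact Nat.le_ceil _
      -- For `l` beyond the length of the string the target is `0` and is met from the start.
      · have : m = 0 := by rw [hm, hD, numSubstrings_eq_zero w h]; simp
        rw [potential, if_pos (by omega)]
        positivity

/-! ### Deterministic execution -/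

/-- Program `p` takes the machine from state `s` to state `s'` without using randomness, in at most
`t` steps. -/
def Exec {σ : ℕ} (w : List (Fin σ)) (p : RProg) (s s' : RState) (t : ℕ) : Prop :=
  ∃ t' ≤ t, ∀ k T, RConfig.run w (t' + T) ⟨p :: k, s⟩ = RConfig.run w T ⟨k, s'⟩

theorem run_succ {σ : ℕ} (w : List (Fin σ)) (T : ℕ) (c : RConfig) :
    RConfig.run w (T + 1) c = (c.step w).bind (RConfig.run w T) := rfl

theorem run_succ_of_step {σ : ℕ} {w : List (Fin σ)} {c c' : RConfig}
    (h : c.step w = PMF.pure c') (T : ℕ) :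
    RConfig.run w (T + 1) c = RConfig.run w T c' := by
  rw [run_succ, h, PMF.pure_bind]

theorem run_halted {σ : ℕ} (w : List (Fin σ)) (s : RState) (T : ℕ) :
    RConfig.run w T ⟨[], s⟩ = PMF.pure ⟨[], s⟩ := by
  induction T with
  | zero => rfl
  | succ T ih => rw [run_succ_of_step (c' := ⟨[], s⟩) rfl, ih]

namespace Exec

variable {σ : ℕ} {w : List (Fin σ)} {p q : RProg} {s s' s'' : RState} {t t' : ℕ}

theorem mono (h : Exec w p s s' t) (ht : t ≤ t') : Exec w p s s' t' := by
  obtain ⟨u, hu, h⟩ := h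
  exact ⟨u, hu.trans ht, h⟩

theorem instr {i : RInstr} (h : i.exec w s = PMF.pure s') : Exec w (.instr i) s s' 1 := by
  refine ⟨1, le_rfl, fun k T => ?_⟩
  rw [add_comm, run_succ_of_step]
  simp [RConfig.step, h, PMF.pure_map]

theorem seq (hp : Exec w p s s' t) (hq : Exec w q s' s'' t') :
    Exec w (.seq p q) s s'' (1 + t + t') := by
  obtain ⟨u, hu, hp⟩ := hp
  obtain ⟨v, hv, hq⟩ := hq
  refine ⟨u + v + 1, by omega, fun k T => ?_⟩
  rw [show u + v + 1 + T = u + (v + T) + 1 by ring, run_succ_of_step (c' := ⟨p :: q :: k, s⟩) rfl,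
    hp, hq]

theorem ite_true {b : RTest} (hb : b.holds s) (hp : Exec w p s s' t) :
    Exec w (.ite b p q) s s' (1 + t) := by
  obtain ⟨u, hu, hp⟩ := hp
  refine ⟨u + 1, by omega, fun k T => ?_⟩
  rw [show u + 1 + T = u + T + 1 by ring, run_succ_of_step (c' := ⟨p :: k, s⟩)
    (by simp [RConfig.step, hb]), hp]

theorem ite_false {b : RTest} (hb : ¬ b.holds s) (hq : Exec w q s s' t) :
    Exec w (.ite b p q) s s' (1 + t) := by
  obtain ⟨u, hu, hq⟩ := hq
  refine ⟨u + 1, by omega, fun k T => ?_⟩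
  rw [show u + 1 + T = u + T + 1 by ring, run_succ_of_step (c' := ⟨q :: k, s⟩)
    (by simp [RConfig.step, hb]), hq]

theorem loop_done {b : RTest} (hb : ¬ b.holds s) : Exec w (.loop b p) s s 1 := by
  refine ⟨1, le_rfl, fun k T => ?_⟩
  rw [add_comm, run_succ_of_step (c' := ⟨k, s⟩) (by simp [RConfig.step, hb])]

theorem loop_step {b : RTest} (hb : b.holds s) (hp : Exec w p s s' t)
    (hl : Exec w (.loop b p) s' s'' t') : Exec w (.loop b p) s s'' (1 + t + t') := by
  obtain ⟨u, hu, hp⟩ := hp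
  obtain ⟨v, hv, hl⟩ := hl
  refine ⟨u + v + 1, by omega, fun k T => ?_⟩
  rw [show u + v + 1 + T = u + (v + T) + 1 by ring,
    run_succ_of_step (c' := ⟨p :: .loop b p :: k, s⟩) (by simp [RConfig.step, hb]), hp, hl]

/-- A loop with an invariant `I i`, `i` being the number of completed iterations. -/
theorem loop {b : RTest} (I : ℕ → RState → Prop) (N : ℕ)
    (hstep : ∀ i s, i < N → I i s → b.holds s ∧ ∃ s', Exec w p s s' t ∧ I (i + 1) s')
    (hdone : ∀ s, I N s → ¬ b.holds s) (h0 : I 0 s) :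
    ∃ s', Exec w (.loop b p) s s' (N * (t + 1) + 1) ∧ I N s' := by
  have key : ∀ d i s, i + d = N → I i s →
      ∃ s', Exec w (.loop b p) s s' (d * (t + 1) + 1) ∧ I N s' := by
    intro d
    induction d with
    | zero =>
      rintro i s rfl hI
      exact ⟨s, (loop_done (hdone s hI)).mono (by omega), hI⟩
    | succ d ih =>
      intro i s hi hI
      obtain ⟨hb, s', hs', hI'⟩ := hstep i s (by omega) hI
      obtain ⟨s'', hs'', hI''⟩ := ih (i + 1) s' (by omega) hI'
      exact ⟨s'', (loop_step hb hs' hs'').mono (by ring_nf; omega), hI''⟩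
  exact key N 0 s (by omega) h0

end Exec

/-- The effect of an instruction other than `rand`. -/
noncomputable def RInstr.apply {σ : ℕ} (w : List (Fin σ)) (s : RState) : RInstr → RState
  | .const x c => { s with reg := Function.update s.reg x c }
  | .add x y z => { s with reg := Function.update s.reg x (s.reg y + s.reg z) }
  | .sub x y z => { s with reg := Function.update s.reg x (s.reg y - s.reg z) }
  | .load x y => { s with reg := Function.update s.reg x (s.mem (s.reg y)) }
  | .store x y => { s with mem := Function.update s.mem (s.reg x) (s.reg y) }
  | .query x y => { s with
      reg := Function.update s.reg x (symbolAt w (s.reg y))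
      queries := s.queries + 1 }
  | .rand _ _ => s
  | .rofNat x y => { s with rreg := Function.update s.rreg x (s.reg y : ℝ) }
  | .radd x y z => { s with rreg := Function.update s.rreg x (s.rreg y + s.rreg z) }
  | .rsub x y z => { s with rreg := Function.update s.rreg x (s.rreg y - s.rreg z) }
  | .rmul x y z => { s with rreg := Function.update s.rreg x (s.rreg y * s.rreg z) }
  | .rdiv x y z => { s with rreg := Function.update s.rreg x (s.rreg y / s.rreg z) }
  | .rsqrt x y => { s with rreg := Function.update s.rreg x (√(s.rreg y)) }
  | .rlog x y => { s with rreg := Function.update s.rreg x (Real.logb 2 (s.rreg y)) }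
  | .rload x y => { s with rreg := Function.update s.rreg x (s.rmem (s.reg y)) }
  | .rstore x y => { s with rmem := Function.update s.rmem (s.reg x) (s.rreg y) }

/-- Instructions other than `rand`. -/
def RInstr.isDet : RInstr → Prop
  | .rand _ _ => False
  | _ => True

theorem RInstr.exec_eq {σ : ℕ} (w : List (Fin σ)) (s : RState) {i : RInstr} (h : i.isDet) :
    i.exec w s = PMF.pure (i.apply w s) := by
  cases i <;> first | rfl | exact h.elim

/-- A sequence of instructions. -/
def block (i : RInstr) : List RInstr → RProg
  | [] => .instr i
  | j :: is => .seq (.instr i) (block j is)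

theorem Exec.block {σ : ℕ} (w : List (Fin σ)) (i : RInstr) (is : List RInstr) (s : RState)
    (h : ∀ j ∈ i :: is, j.isDet) :
    Exec w (block i is) s ((i :: is).foldl (RInstr.apply w) s) (2 * is.length + 1) := by
  induction is generalizing i s with
  | nil => exact Exec.instr (RInstr.exec_eq w s (h i (by simp)))
  | cons j is ih =>
    refine (Exec.seq (Exec.instr (RInstr.exec_eq w s (h i (by simp))))
      (ih j _ fun j' hj' => h j' (List.mem_cons_of_mem _ hj'))).mono ?_
    simp; omega

/-! ### Failure probabilities -/

/-- Started from `c`, the machine has halted in a state that satisfies `Q` after any number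
`T' ≥ T` of steps, except with probability at most `δ`. -/
def Fails {σ : ℕ} (w : List (Fin σ)) (Q : RState → Prop) (c : RConfig) (T : ℕ) (δ : ℝ) : Prop :=
  ∀ T' ≥ T, (RConfig.run w T' c).toOuterMeasure {r | ¬ (r.todo = [] ∧ Q r.state)} ≤
    ENNReal.ofReal δ

namespace Fails

variable {σ : ℕ} {w : List (Fin σ)} {Q : RState → Prop} {p q : RProg} {k : List RProg}
  {s s' : RState} {c : RConfig} {t T T' : ℕ} {δ δ' : ℝ}

theorem mono (h : Fails w Q c T δ) (hT : T ≤ T') (hδ : δ ≤ δ') : Fails w Q c T' δ' :=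
  fun U hU => (h U (hT.trans hU)).trans (ENNReal.ofReal_le_ofReal hδ)

theorem halted (h : Q s) : Fails w Q ⟨[], s⟩ 0 0 := by
  intro T _
  rw [run_halted, PMF.toOuterMeasure_pure_apply, if_neg (by simp [h])]
  simp

/-- For bad final samples the bound is vacuous, so the rest of the run need not be followed. -/
theorem of_one_le (hδ : 1 ≤ δ) : Fails w Q c T δ := by
  intro T' _
  calc _ ≤ (RConfig.run w T' c).toOuterMeasure Set.univ :=
        (RConfig.run w T' c).toOuterMeasure.mono (Set.subset_univ _)
    _ = 1 := (PMF.toOuterMeasure_apply_eq_one_iff _ _).2 (Set.subset_univ _)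
    _ ≤ _ := by simpa using hδ

theorem of_exec (h : Exec w p s s' t) (hf : Fails w Q ⟨k, s'⟩ T δ) :
    Fails w Q ⟨p :: k, s⟩ (t + T) δ := by
  obtain ⟨u, hu, h⟩ := h
  intro T' hT'
  obtain ⟨v, rfl⟩ := Nat.exists_eq_add_of_le (show u ≤ T' by omega)
  rw [h]
  exact hf v (by omega)

theorem of_step {c' : RConfig} (h : c.step w = PMF.pure c') (hf : Fails w Q c' T δ) :
    Fails w Q c (T + 1) δ := by
  intro T' hT'
  obtain ⟨v, rfl⟩ := Nat.exists_eq_add_of_le (show 1 ≤ T' by omega)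
  rw [add_comm, run_succ_of_step h]
  exact hf v (by omega)

theorem seq (hf : Fails w Q ⟨p :: q :: k, s⟩ T δ) : Fails w Q ⟨.seq p q :: k, s⟩ (T + 1) δ :=
  of_step rfl hf

theorem ite_false {b : RTest} (hb : ¬ b.holds s) (hf : Fails w Q ⟨q :: k, s⟩ T δ) :
    Fails w Q ⟨.ite b p q :: k, s⟩ (T + 1) δ :=
  of_step (by simp [RConfig.step, hb]) hf

theorem loop_true {b : RTest} (hb : b.holds s) (hf : Fails w Q ⟨p :: .loop b p :: k, s⟩ T δ) :
    Fails w Q ⟨.loop b p :: k, s⟩ (T + 1) δ :=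
  of_step (by simp [RConfig.step, hb]) hf

theorem loop_false {b : RTest} (hb : ¬ b.holds s) (hf : Fails w Q ⟨k, s⟩ T δ) :
    Fails w Q ⟨.loop b p :: k, s⟩ (T + 1) δ :=
  of_step (by simp [RConfig.step, hb]) hf

/-- Total probability: the failure bound before a draw is the average of the bounds after it. Here
the supermartingale inequality enters. -/
theorem rand {x y n : ℕ} (hn : 0 < n) (hy : s.reg y = n) {d : Fin n → ℝ} (hd : ∀ j, 0 ≤ d j)
    (hf : ∀ j : Fin n,
      Fails w Q ⟨k, { s with reg := Function.update s.reg x (j : ℕ) }⟩ T (d j)) :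
    Fails w Q ⟨.instr (.rand x y) :: k, s⟩ (T + 1) ((∑ j, d j) / n) := by
  intro T' hT'
  obtain ⟨v, rfl⟩ := Nat.exists_eq_add_of_le (show 1 ≤ T' by omega)
  obtain ⟨m, rfl⟩ := Nat.exists_eq_add_of_le' hn
  rw [add_comm, run_succ]
  simp only [RConfig.step, RInstr.exec, hy, uniformBelow, PMF.map_comp]
  rw [PMF.bind_map, PMF.toOuterMeasure_bind_apply, tsum_fintype]
  simp only [PMF.uniformOfFintype_apply, Fintype.card_fin, Function.comp]
  have hm : (0 : ℝ) < ((m + 1 : ℕ) : ℝ) := by positivity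
  rw [Finset.sum_div, ENNReal.ofReal_sum_of_nonneg fun j _ => div_nonneg (hd j) hm.le]
  refine Finset.sum_le_sum fun j _ => ?_
  rw [div_eq_inv_mul, ENNReal.ofReal_mul (inv_nonneg.2 hm.le), ENNReal.ofReal_inv_of_pos hm,
    ENNReal.ofReal_natCast]
  gcongr
  exact hf j v (by omega)

end Fails

/-! ### Queries are steps -/

theorem queries_le_of_mem_support {σ : ℕ} (w : List (Fin σ)) (T : ℕ) (c : RConfig) :
    ∀ r ∈ (RConfig.run w T c).support, r.state.queries ≤ c.state.queries + T := by
  induction T generalizing c with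
  | zero =>
    intro r hr
    rw [RConfig.run, PMF.mem_support_pure_iff] at hr
    simp [hr]
  | succ T ih =>
    intro r hr
    rw [run_succ, PMF.mem_support_bind_iff] at hr
    obtain ⟨c', hc', hr⟩ := hr
    have hstep : c'.state.queries ≤ c.state.queries + 1 := by
      rcases c with ⟨_ | ⟨p, k⟩, s⟩
      · simp only [RConfig.step, PMF.mem_support_pure_iff] at hc'
        simp [hc']
      · cases p with
        | instr i =>
          simp only [RConfig.step, PMF.mem_support_map_iff] at hc'
          obtain ⟨s', hs', rfl⟩ := hc'
          cases i <;> simp only [RInstr.exec, PMF.mem_support_pure_iff,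
            PMF.mem_support_map_iff] at hs' <;>
            (obtain ⟨v, -, rfl⟩ := hs'; simp)
        | _ =>
          simp only [RConfig.step, PMF.mem_support_pure_iff] at hc'
          simp [hc']
    have := ih c' r hr
    omega

/-! ### Tries in the memory of the machine -/

/-- The memory holds the trie of the set `S` of non-empty strings, which is closed under taking
prefixes. The node of a string `u` has number `id u`, the root has number `0`, and the memory cell
`σ * id u + a` holds `σ` times the number of the child of this node for the symbol `a` (or `0`).
The numbers from `C` on are unused. The cell `l` of the real memory holds `B` times the number of
nodes of depth `l`. -/
structure Trie {σ : ℕ} (B : ℝ) (S : Finset (List (Fin σ))) (id : List (Fin σ) → ℕ) (C : ℕ)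
    (mem : ℕ → ℕ) (rmem : ℕ → ℝ) : Prop where
  pos : 0 < C
  id_nil : id [] = 0
  injOn : Set.InjOn id (insert [] (S : Set (List (Fin σ))))
  id_lt : ∀ u ∈ insert [] S, id u < C
  id_pos : ∀ u ∈ S, 0 < id u
  closed : ∀ u a, u ++ [a] ∈ S → u ∈ insert [] S
  child : ∀ u ∈ insert [] S, ∀ a : Fin σ,
    mem (σ * id u + a) = if u ++ [a] ∈ S then σ * id (u ++ [a]) else 0
  fresh : ∀ x, σ * C ≤ x → mem x = 0
  count : ∀ l, rmem l = (S.filter fun u => u.length = l).card * B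

/-- Different nodes own disjoint blocks of `σ` cells. -/
theorem mul_add_inj {σ i j a b : ℕ} (ha : a < σ) (hb : b < σ) (h : σ * i + a = σ * j + b) :
    i = j ∧ a = b := by
  have h1 : (σ * i + a) / σ = i := by
    rw [Nat.mul_add_div (by omega), Nat.div_eq_of_lt ha, add_zero]
  have h2 : (σ * j + b) / σ = j := by
    rw [Nat.mul_add_div (by omega), Nat.div_eq_of_lt hb, add_zero]
  have : i = j := by rw [← h1, ← h2, h]
  subst this
  exact ⟨rfl, by omega⟩

theorem Trie.empty {σ : ℕ} (B : ℝ) :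
    Trie B (∅ : Finset (List (Fin σ))) (fun _ => 0) 1 (fun _ => 0) (fun _ => 0) where
  pos := one_pos
  id_nil := rfl
  injOn := by simp
  id_lt := by simp
  id_pos := by simp
  closed := by simp
  child := by simp
  fresh := by simp
  count := by simp

/-- Only one pointer and one counter change. The block of the new node has never been written to, so
it already says that there are no children; no initialization has to be paid for. -/
theorem Trie.add_node {σ : ℕ} {B : ℝ} {S : Finset (List (Fin σ))} {id : List (Fin σ) → ℕ}
    {C : ℕ} {mem : ℕ → ℕ} {rmem : ℕ → ℝ} (h : Trie B S id C mem rmem) {u : List (Fin σ)}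
    (hu : u ∈ insert [] S) {a : Fin σ} (ha : u ++ [a] ∉ S) {l : ℕ} (hl : u.length + 1 = l) :
    Trie B (insert (u ++ [a]) S) (Function.update id (u ++ [a]) C) (C + 1)
      (Function.update mem (σ * id u + a) (σ * C))
      (Function.update rmem l (rmem l + B)) := by
  have hne : ∀ v ∈ insert [] S, v ≠ u ++ [a] := by
    rintro v hv rfl
    simp [ha] at hv
  have hid : ∀ v ∈ insert [] S, Function.update id (u ++ [a]) C v = id v := fun v hv =>
    Function.update_of_ne (hne v hv) _ _
  have hins : ∀ v, v ∈ insert [] (insert (u ++ [a]) S) → v = u ++ [a] ∨ v ∈ insert [] S := by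
    intro v hv
    simp only [Finset.mem_insert] at hv ⊢
    tauto
  have hσ : 0 < σ := a.pos
  constructor
  · omega
  · rw [hid _ (by simp), h.id_nil]
  · intro v hv v' hv' hvv
    have hv := hins v (by simpa using hv)
    have hv' := hins v' (by simpa using hv')
    rcases hv with rfl | hv <;> rcases hv' with rfl | hv'
    · rfl
    · rw [Function.update_self, hid _ hv'] at hvv
      exact absurd (h.id_lt v' hv') (by omega)
    · rw [Function.update_self, hid _ hv] at hvv
      exact absurd (h.id_lt v hv) (by omega)
    · rw [hid _ hv, hid _ hv'] at hvv
      exact h.injOn (by simpa using hv) (by simpa using hv') hvv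
  · intro v hv
    rcases hins v hv with rfl | hv
    · simp
    · rw [hid _ hv]
      have := h.id_lt v hv
      omega
  · intro v hv
    rcases Finset.mem_insert.1 hv with rfl | hv
    · rw [Function.update_self]; exact h.pos
    · rw [hid _ (Finset.mem_insert_of_mem hv)]; exact h.id_pos v hv
  · intro v b hvb
    rcases Finset.mem_insert.1 hvb with hvb | hvb
    · obtain rfl := (List.append_inj' hvb rfl).1
      simp only [Finset.mem_insert] at hu ⊢
      tauto
    · have := h.closed v b hvb
      simp only [Finset.mem_insert] at this ⊢
      tauto
  · intro v hv b
    rcases hins v hv with rfl | hv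
    · have hlt := h.id_lt u hu
      rw [Function.update_self, Function.update_of_ne, h.fresh _ (Nat.le_add_right _ _), if_neg]
      · intro hmem
        rcases Finset.mem_insert.1 hmem with hmem | hmem
        · simpa using congrArg List.length hmem
        · exact hne _ (h.closed _ _ hmem) rfl
      · intro he
        exact absurd (mul_add_inj b.isLt a.isLt he).1 (by omega)
    · rw [hid v hv]
      by_cases he : v ++ [b] = u ++ [a]
      · obtain ⟨rfl, hab⟩ := List.append_inj' he rfl
        obtain rfl : b = a := by simpa using hab
        rw [Function.update_self, Function.update_self, if_pos (Finset.mem_insert_self _ _)]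
      · rw [Function.update_of_ne, h.child v hv b, Function.update_of_ne he]
        · simp only [Finset.mem_insert, he, false_or]
        · intro hadd
          obtain ⟨h1, h2⟩ := mul_add_inj b.isLt a.isLt hadd
          refine he ?_
          rw [h.injOn (by simpa using hv) (by simpa using hu) h1, Fin.ext h2]
  · intro x hx
    have h1 := h.id_lt u hu
    have h2 := a.isLt
    have h3 : σ * (C + 1) = σ * C + σ := by ring
    have h4 : σ * id u ≤ σ * C := Nat.mul_le_mul_left σ h1.le
    rw [Function.update_of_ne (by omega), h.fresh x (by omega)]
  · intro k
    rw [Finset.filter_insert]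
    by_cases hk : k = l
    · subst hk
      rw [Function.update_self, if_pos (by simpa using hl),
        Finset.card_insert_of_notMem (by simp [ha]), h.count]
      push_cast
      ring
    · rw [Function.update_of_ne hk, if_neg (by simp; omega), h.count]

/-! ### The program -/

/-- Compute `x = 2 / (A ε)`, `B`, `n` and `√n` as real numbers in the real registers 2 to 5. -/
def preludeProg : RProg :=
  block (.const 2 1) [.const 17 2, .rofNat 10 17, .rmul 2 0 1, .rdiv 2 10 2, .rlog 8 2,
    .rsqrt 8 8, .rmul 8 10 8, .rdiv 3 0 8, .rofNat 4 0, .rsqrt 5 4]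

/-- The output if `B` exceeds `√n`. -/
def trivialProg : RProg :=
  block (.rdiv 8 0 3) [.rmul 8 8 5, .rmul 7 1 4, .radd 0 8 7]

/-- Compute `ℓ₀` in register 4. -/
def ellProg : RProg :=
  .seq (.instr (.rofNat 7 4)) (.loop (.rlt 7 2) (block (.add 4 4 2) [.rofNat 7 4]))

/-- Compute the number of rounds of the sampling loop in real register 6. -/
def boundProg : RProg :=
  .seq (block (.rmul 11 3 3) [.rdiv 6 4 11, .radd 12 10 10, .rmul 6 6 12, .add 15 4 4,
    .add 15 15 4, .rofNat 8 15, .rlog 8 8, .rofNat 13 2, .radd 8 8 13, .rmul 6 6 8,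
    .add 14 1 3])
  (.ite (.rlt 11 10) (block (.const 16 1) [.rofNat 6 0]) (.instr (.const 16 0)))

/-- Go from a node of the trie to its child for the next symbol, creating it if necessary. -/
def descendProg : RProg :=
  .seq (block (.add 10 6 8) [.query 11 10, .add 12 7 11, .load 13 12, .add 8 8 2])
  (.seq (.ite (.lt 3 13) (.instr (.add 13 13 3))
      (block (.store 12 14) [.add 13 14 3, .add 14 14 1, .rload 7 8, .radd 7 7 3, .rstore 8 7]))
    (.instr (.add 7 13 3)))

/-- Insert the substrings that start at the position in register 6 into the trie. -/
def insertProg : RProg :=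
  .seq (block (.const 7 0) [.const 8 0, .sub 9 0 6])
  (.seq (.ite (.lt 4 9) (.instr (.add 9 4 3)) (.instr (.add 9 9 3)))
    (.loop (.lt 8 9) descendProg))

/-- One round of the sampling loop. -/
def roundProg : RProg :=
  .seq (.instr (.rand 6 0))
  (.seq (.ite (.lt 3 16) (.instr (.add 6 5 3)) (.instr (.add 6 6 3)))
  (.seq insertProg
    (block (.add 5 5 2) [.rofNat 7 5])))

/-- Compute the maximum of the estimates divided by the lengths, and the output. -/
def outputProg : RProg :=
  .seq (.instr (.const 8 0))
  (.seq (.loop (.lt 8 4)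
    (.seq (block (.add 8 8 2) [.rload 8 8, .rofNat 7 8, .rdiv 8 8 7])
      (.ite (.rlt 9 8) (.instr (.radd 9 8 14)) (.instr (.radd 9 9 14)))))
    (block (.rdiv 8 0 3) [.rmul 8 8 9, .rmul 7 1 4, .radd 0 8 7]))

/-- The part of the algorithm that is executed if `B` is at most `√n`. -/
def mainProg : RProg :=
  .seq ellProg (.seq boundProg (.seq insertProg (.seq (.instr (.rofNat 7 5))
    (.seq (.loop (.rlt 7 6) roundProg) outputProg))))

/-- The algorithm. -/
def lzProg : RProg := .seq preludeProg (.ite (.rlt 5 3) trivialProg mainProg)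

/-! ### Correctness of the parts -/

/-- The registers that hold the parameters during the sampling loop. -/
structure Params (n σ L : ℕ) (A ε B bound : ℝ) (s : RState) : Prop where
  reg0 : s.reg 0 = n
  reg1 : s.reg 1 = σ
  reg2 : s.reg 2 = 1
  reg3 : s.reg 3 = 0
  reg4 : s.reg 4 = L
  reg16 : s.reg 16 = if B * B < 2 then 1 else 0
  rreg0 : s.rreg 0 = A
  rreg1 : s.rreg 1 = ε
  rreg3 : s.rreg 3 = B
  rreg4 : s.rreg 4 = n
  rreg6 : s.rreg 6 = bound
  rreg9 : s.rreg 9 = 0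
  rreg14 : s.rreg 14 = 0

/-- The memory of the machine holds the trie of `S`. -/
def HasTrie {σ : ℕ} (B : ℝ) (S : Finset (List (Fin σ))) (s : RState) : Prop :=
  ∃ id C, Trie B S id C s.mem s.rmem ∧ s.reg 14 = σ * C

theorem symbolAt_of_lt {σ : ℕ} {w : List (Fin σ)} {i : ℕ} (h : i < w.length) :
    symbolAt w i = w[i] := by
  simp [symbolAt, h]

theorem window_succ {α : Type*} {w : List α} {l p : ℕ} (h : p + l < w.length) :
    window w (l + 1) p = window w l p ++ [w[p + l]] := by
  rw [window, window, List.take_add_one]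
  simp [h]

/-- Nodes are represented by the addresses `σ * id`, since the machine cannot multiply natural
numbers; a new address arises by adding `σ` in register 14. A positive cell content means that the
child exists. -/
theorem exec_descendProg {σ n L : ℕ} {w : List (Fin σ)} {A ε B bound : ℝ} {s : RState}
    {S : Finset (List (Fin σ))} {id : List (Fin σ) → ℕ} {C p l i M : ℕ}
    (hP : Params n σ L A ε B bound s) (hT : Trie B S id C s.mem s.rmem)
    (h14 : s.reg 14 = σ * C) (h6 : s.reg 6 = p) (h8 : s.reg 8 = l) (h5 : s.reg 5 = i)
    (h9 : s.reg 9 = M) (hpl : p + l < w.length) (hS : window w l p ∈ insert [] S)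
    (h7 : s.reg 7 = σ * id (window w l p)) :
    ∃ s', Exec w descendProg s s' 30 ∧ Params n σ L A ε B bound s' ∧
      s'.reg 6 = p ∧ s'.reg 8 = l + 1 ∧ s'.reg 5 = i ∧ s'.reg 9 = M ∧
      ∃ id' C', Trie B (insert (window w (l + 1) p) S) id' C' s'.mem s'.rmem ∧
        s'.reg 14 = σ * C' ∧ s'.reg 7 = σ * id' (window w (l + 1) p) := by
  rw [window_succ hpl]
  set u := window w l p with hu
  set a := w[p + l] with ha
  have hlen : u.length + 1 = l + 1 := by rw [hu, length_window w hpl.le]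
  have hσ : 0 < σ := a.pos
  have hchild := hT.child u hS a
  have e1 := Exec.block w (.add 10 6 8) [.query 11 10, .add 12 7 11, .load 13 12, .add 8 8 2] s
    (by simp [RInstr.isDet])
  set s1 := List.foldl (RInstr.apply w) s
    [.add 10 6 8, .query 11 10, .add 12 7 11, .load 13 12, .add 8 8 2] with hs1
  have hsym : symbolAt w (p + l) = (a : ℕ) := symbolAt_of_lt hpl
  simp [RInstr.apply, h6, h8, h7, hP.reg2, hsym] at hs1
  by_cases hmem : u ++ [a] ∈ S
  · rw [if_pos hmem] at hchild
    have hpos := Nat.mul_pos hσ (hT.id_pos _ hmem)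
    have e2 : Exec w (.instr (.add 13 13 3)) s1 _ 1 := Exec.instr (RInstr.exec_eq w s1 trivial)
    have e3 : Exec w (.instr (.add 7 13 3)) (RInstr.apply w s1 (.add 13 13 3)) _ 1 :=
      Exec.instr (RInstr.exec_eq w _ trivial)
    have e2' := Exec.ite_true (b := .lt 3 13) (q := block (.store 12 14)
      [.add 13 14 3, .add 14 14 1, .rload 7 8, .radd 7 7 3, .rstore 8 7])
      (show s1.reg 3 < s1.reg 13 by simp [hs1, hP.reg3, hchild, hpos]) e2
    refine ⟨_, ((e1.seq (e2'.seq e3)).mono (by simp)), ?_, ?_, ?_, ?_, ?_, id, C, ?_, ?_, ?_⟩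
    · obtain ⟨⟩ := hP
      constructor <;> simp [RInstr.apply, *]
    · simp [RInstr.apply, *]
    · simp [RInstr.apply, *]
    · simp [RInstr.apply, *]
    · simp [RInstr.apply, *]
    · rw [Finset.insert_eq_of_mem hmem]
      simpa [RInstr.apply, hs1] using hT
    · simp [RInstr.apply, *]
    · simp [RInstr.apply, hs1, hP.reg3, hchild]
  · rw [if_neg hmem] at hchild
    have e2 := Exec.block w (.store 12 14)
      [.add 13 14 3, .add 14 14 1, .rload 7 8, .radd 7 7 3, .rstore 8 7] s1
      (by simp [RInstr.isDet])
    set s2 := List.foldl (RInstr.apply w) s1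
      [.store 12 14, .add 13 14 3, .add 14 14 1, .rload 7 8, .radd 7 7 3, .rstore 8 7] with hs2
    simp [RInstr.apply] at hs2
    have e3 : Exec w (.instr (.add 7 13 3)) s2 _ 1 := Exec.instr (RInstr.exec_eq w _ trivial)
    have e2' := Exec.ite_false (b := .lt 3 13) (p := .instr (.add 13 13 3))
      (show ¬ s1.reg 3 < s1.reg 13 by simp [hs1, hP.reg3, hchild]) e2
    refine ⟨_, ((e1.seq (e2'.seq e3)).mono (by simp)), ?_, ?_, ?_, ?_, ?_,
      Function.update id (u ++ [a]) C, C + 1, ?_, ?_, ?_⟩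
    rotate_left 5
    · have := hT.add_node hS hmem hlen
      convert this using 1
      · simp [RInstr.apply, hs2, hs1, h14]
      · simp [RInstr.apply, hs2, hs1, hP.rreg3]
    · simp [RInstr.apply, hs2, hs1, h14, hP.reg1]; ring
    · simp [RInstr.apply, hs2, hs1, h14, hP.reg3]
    · obtain ⟨⟩ := hP
      constructor <;> simp [RInstr.apply, *]
    · simp [RInstr.apply, *]
    · simp [RInstr.apply, *]
    · simp [RInstr.apply, *]
    · simp [RInstr.apply, *]

theorem sampled_insert {α : Type*} [DecidableEq α] (w : List α) (L p : ℕ) (ps : Finset ℕ) :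
    sampled w L (insert p ps) = sampled w L ps ∪
      (Finset.Icc 1 (min L (w.length - p))).image fun l => window w l p := by
  rw [sampled, Finset.biUnion_insert, Finset.union_comm]; rfl

theorem exec_insertProg {σ L : ℕ} {w : List (Fin σ)} {A ε B bound : ℝ} {s : RState}
    {ps : Finset ℕ} {p i : ℕ} (hP : Params w.length σ L A ε B bound s)
    (hT : HasTrie B (sampled w L ps) s) (h6 : s.reg 6 = p) (h5 : s.reg 5 = i) :
    ∃ s', Exec w insertProg s s' (31 * L + 11) ∧ Params w.length σ L A ε B bound s' ∧
      HasTrie B (sampled w L (insert p ps)) s' ∧ s'.reg 5 = i := by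
  obtain ⟨id, C, hT, h14⟩ := hT
  set M := min L (w.length - p) with hM
  have e1 := Exec.block w (.const 7 0) [.const 8 0, .sub 9 0 6] s (by simp [RInstr.isDet])
  set s1 := List.foldl (RInstr.apply w) s [.const 7 0, .const 8 0, .sub 9 0 6] with hs1
  simp [RInstr.apply, h6, hP.reg0] at hs1
  have e2 : ∃ s2, Exec w (.ite (.lt 4 9) (.instr (.add 9 4 3)) (.instr (.add 9 9 3))) s1 s2 2 ∧
      s2 = { s1 with reg := Function.update s1.reg 9 M } := by
    by_cases h : L < w.length - p
    · refine ⟨_, Exec.ite_true ?_ (Exec.instr (RInstr.exec_eq w s1 (by trivial))), ?_⟩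
      · show s1.reg 4 < s1.reg 9
        simpa [hs1, hP.reg4] using h
      · simp [RInstr.apply, hs1, hP.reg4, hP.reg3, hM, min_eq_left h.le]
    · refine ⟨_, Exec.ite_false ?_ (Exec.instr (RInstr.exec_eq w s1 (by trivial))), ?_⟩
      · show ¬ s1.reg 4 < s1.reg 9
        simpa [hs1, hP.reg4] using h
      · simp [RInstr.apply, hs1, hP.reg3, hM, min_eq_right (not_lt.1 h)]
  obtain ⟨s2, e2, hs2⟩ := e2
  simp [hs1] at hs2
  -- Invariant: after `l` descents the prefixes of lengths `1` to `l` are in the trie and register 7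
  -- points to the node of the last one.
  obtain ⟨s', e3, hI⟩ := Exec.loop (w := w) (b := .lt 8 9) (p := descendProg) (t := 30) (s := s2)
    (fun l s => Params w.length σ L A ε B bound s ∧ s.reg 6 = p ∧ s.reg 8 = l ∧ s.reg 5 = i ∧
      s.reg 9 = M ∧ ∃ id C, Trie B (sampled w L ps ∪
        (Finset.Icc 1 l).image fun l => window w l p) id C s.mem s.rmem ∧
        s.reg 14 = σ * C ∧ s.reg 7 = σ * id (window w l p)) M
    (by
      rintro l s hl ⟨hP, h6, h8, h5, h9, id, C, hT, h14, h7⟩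
      refine ⟨show s.reg 8 < s.reg 9 by omega, ?_⟩
      have hmem : window w l p ∈ insert [] (sampled w L ps ∪
          (Finset.Icc 1 l).image fun l => window w l p) := by
        rcases Nat.eq_zero_or_pos l with rfl | hl
        · simp [window]
        · exact Finset.mem_insert_of_mem (Finset.mem_union_right _
            (Finset.mem_image_of_mem _ (Finset.mem_Icc.2 ⟨hl, le_rfl⟩)))
      obtain ⟨s', e, hP', h6', h8', h5', h9', id', C', hT', h14', h7'⟩ :=
        exec_descendProg hP hT h14 h6 h8 h5 h9 (by omega) hmem h7
      refine ⟨s', e, hP', h6', h8', h5', h9', id', C', ?_, h14', h7'⟩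
      have hIcc : Finset.Icc 1 (l + 1) = insert (l + 1) (Finset.Icc 1 l) := by
        ext; simp; omega
      rwa [hIcc, Finset.image_insert,
        Finset.union_insert])
    (by
      rintro s ⟨-, -, h8, -, h9, -⟩
      show ¬ s.reg 8 < s.reg 9
      omega)
    (by
      refine ⟨?_, ?_, ?_, ?_, ?_, id, C, ?_, ?_, ?_⟩
      · obtain ⟨⟩ := hP
        constructor <;> simp [*]
      · simp [*]
      · simp [*]
      · simp [*]
      · simp [*]
      · simpa [hs2] using hT
      · simp [*]
      · simp [hs2, window, hT.id_nil])
  obtain ⟨hP', -, -, h5', -, id', C', hT', h14', -⟩ := hI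
  have hML : M * (30 + 1) ≤ L * (30 + 1) := Nat.mul_le_mul_right _ (min_le_left _ _)
  refine ⟨s', (e1.seq (e2.seq e3)).mono (by simp; omega), hP', ⟨id', C', ?_, h14'⟩, h5'⟩
  rwa [sampled_insert]

/-- Backward induction over the rounds. The test compares the counter with the real number `bound`,
so exactly `⌈bound⌉₊` rounds take place although the machine cannot round. -/
theorem fails_samplingLoop {σ L : ℕ} {w : List (Fin σ)} {A ε B bound : ℝ}
    (hw : w ≠ []) {k : List RProg} {Q : RState → Prop} {T : ℕ} {Φ : ℕ → Finset ℕ → ℝ}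
    (hΦ0 : ∀ i ps, 0 ≤ Φ i ps)
    (hΦ : ∀ i ps, i < ⌈bound⌉₊ →
        (∑ j : Fin w.length, Φ (i + 1) (insert (chosen B i j) ps)) / w.length ≤ Φ i ps)
    (hend : ∀ ps s, Params w.length σ L A ε B bound s → HasTrie B (sampled w L ps) s →
      Fails w Q ⟨k, s⟩ T (Φ ⌈bound⌉₊ ps))
    {i : ℕ} {ps : Finset ℕ} {s : RState} (hi : i ≤ ⌈bound⌉₊)
    (hP : Params w.length σ L A ε B bound s) (hT : HasTrie B (sampled w L ps) s)
    (h5 : s.reg 5 = i) (h7 : s.rreg 7 = i) :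
    Fails w Q ⟨.loop (.rlt 7 6) roundProg :: k, s⟩
      ((⌈bound⌉₊ - i) * (31 * L + 23) + T + 1) (Φ i ps) := by
  obtain ⟨d, hd⟩ := Nat.exists_eq_add_of_le hi
  induction d generalizing i ps s with
  | zero =>
    have hi' : i = ⌈bound⌉₊ := by omega
    refine (Fails.loop_false ?_ (hi' ▸ hend ps s hP hT)).mono (by omega) le_rfl
    show ¬ s.rreg 7 < s.rreg 6
    rw [h7, hP.rreg6, not_lt, hi']
    exact Nat.le_ceil _
  | succ d ih =>
    have hlt : i < ⌈bound⌉₊ := by omega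
    have hb : (RTest.rlt 7 6).holds s := by
      show s.rreg 7 < s.rreg 6
      rw [h7, hP.rreg6]
      exact Nat.lt_ceil.1 hlt
    refine (Fails.loop_true hb (Fails.seq (Fails.rand (List.length_pos_of_ne_nil hw) hP.reg0
      (d := fun j => Φ (i + 1) (insert (chosen B i j) ps)) (fun j => hΦ0 _ _)
      (T := (⌈bound⌉₊ - (i + 1)) * (31 * L + 23) + T + 1 + (31 * L + 20)) fun j => ?_))).mono ?_
      (hΦ i ps hlt)
    · have e2 : ∃ s2, Exec w (.ite (.lt 3 16) (.instr (.add 6 5 3)) (.instr (.add 6 6 3)))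
          { s with reg := Function.update s.reg 6 (j : ℕ) } s2 2 ∧
          s2 = { s with reg := Function.update s.reg 6 (chosen B i j) } := by
        by_cases h : B * B < 2
        · refine ⟨_, Exec.ite_true ?_ (Exec.instr (RInstr.exec_eq w _ (by trivial))), ?_⟩
          · show Function.update s.reg 6 (j : ℕ) 3 < Function.update s.reg 6 (j : ℕ) 16
            simp [hP.reg3, hP.reg16, h]
          · simp [RInstr.apply, hP.reg3, h5, chosen, h]
        · refine ⟨_, Exec.ite_false ?_ (Exec.instr (RInstr.exec_eq w _ (by trivial))), ?_⟩
          · show ¬ Function.update s.reg 6 (j : ℕ) 3 < Function.update s.reg 6 (j : ℕ) 16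
            simp [hP.reg3, hP.reg16, h]
          · simp [RInstr.apply, hP.reg3, chosen, h]
      obtain ⟨s2, e2, hs2⟩ := e2
      have hP2 : Params w.length σ L A ε B bound s2 := by
        obtain ⟨⟩ := hP
        constructor <;> simp [*]
      have hT2 : HasTrie B (sampled w L ps) s2 := by simpa [HasTrie, hs2] using hT
      obtain ⟨s3, e3, hP3, hT3, h53⟩ := exec_insertProg hP2 hT2 (p := chosen B i j) (i := i)
        (by simp [hs2]) (by simp [hs2, h5])
      have e4 := Exec.block w (.add 5 5 2) [.rofNat 7 5] s3 (by simp [RInstr.isDet])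
      set s4 := List.foldl (RInstr.apply w) s3 [.add 5 5 2, .rofNat 7 5] with hs4
      simp [RInstr.apply, h53, hP3.reg2] at hs4
      refine (Fails.of_exec (e2.seq (e3.seq e4)) (ih (i := i + 1) (by omega) ?_ ?_ ?_ ?_
        (by omega))).mono ?_ le_rfl
      · obtain ⟨⟩ := hP3
        constructor <;> simp [*]
      · simpa [HasTrie, hs4] using hT3
      · simp [hs4]
      · simp [hs4]
      · simp only [List.length_cons, List.length_nil]; omega
    · have : ⌈bound⌉₊ - i = (⌈bound⌉₊ - (i + 1)) + 1 := by omega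
      rw [this, add_mul]
      omega

theorem exec_outputProg {σ L : ℕ} {w : List (Fin σ)} {A ε bound : ℝ} {s : RState}
    (hL : L = lzEll A ε) (hL1 : 1 ≤ L) (hP : Params w.length σ L A ε (lzB A ε) bound s)
    (hpos : ∀ l, 0 ≤ s.rmem l) :
    ∃ s', Exec w outputProg s s' (12 * L + 12) ∧ s'.rmem = s.rmem ∧
      s'.rreg 0 = lzCombine A ε w.length s.rmem := by
  have e0 : Exec w (.instr (.const 8 0)) s _ 1 := Exec.instr (RInstr.exec_eq w s trivial)
  set m := s.rmem with hm
  obtain ⟨s1, e1, hI⟩ := Exec.loop (w := w) (b := .lt 8 4)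
    (p := .seq (block (.add 8 8 2) [.rload 8 8, .rofNat 7 8, .rdiv 8 8 7])
      (.ite (.rlt 9 8) (.instr (.radd 9 8 14)) (.instr (.radd 9 9 14)))) (t := 10)
    (s := RInstr.apply w s (.const 8 0))
    (fun i s => s.reg 8 = i ∧ s.reg 4 = L ∧ s.reg 2 = 1 ∧ s.rreg 0 = A ∧ s.rreg 1 = ε ∧
      s.rreg 3 = lzB A ε ∧ s.rreg 4 = w.length ∧ s.rreg 14 = 0 ∧ s.rmem = m ∧ 0 ≤ s.rreg 9 ∧
      (∀ l ∈ Set.Icc 1 i, m l / l ≤ s.rreg 9) ∧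
      (s.rreg 9 = 0 ∨ ∃ l ∈ Set.Icc 1 i, s.rreg 9 = m l / l)) L
    (by
      rintro i s hi ⟨h8, h4, h2, hA, hε, hB, hn, h14, hmem, h9, hle, hmax⟩
      refine ⟨show s.reg 8 < s.reg 4 by omega, ?_⟩
      have e1 := Exec.block w (.add 8 8 2) [.rload 8 8, .rofNat 7 8, .rdiv 8 8 7] s
        (by simp [RInstr.isDet])
      set s1 := List.foldl (RInstr.apply w) s
        [.add 8 8 2, .rload 8 8, .rofNat 7 8, .rdiv 8 8 7] with hs1
      simp [RInstr.apply, h8, h2, hmem] at hs1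
      have e2 : ∃ s2, Exec w (.ite (.rlt 9 8) (.instr (.radd 9 8 14)) (.instr (.radd 9 9 14)))
          s1 s2 2 ∧ s2 = { s1 with
            rreg := Function.update s1.rreg 9 (max (s.rreg 9) (m (i + 1) / ((i : ℝ) + 1))) } := by
        by_cases h : s.rreg 9 < m (i + 1) / ((i : ℝ) + 1)
        · refine ⟨_, Exec.ite_true ?_ (Exec.instr (RInstr.exec_eq w s1 (by trivial))), ?_⟩
          · show s1.rreg 9 < s1.rreg 8
            simpa [hs1] using h
          · simp [RInstr.apply, hs1, h14, max_eq_right h.le]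
        · refine ⟨_, Exec.ite_false ?_ (Exec.instr (RInstr.exec_eq w s1 (by trivial))), ?_⟩
          · show ¬ s1.rreg 9 < s1.rreg 8
            simpa [hs1] using h
          · simp [RInstr.apply, hs1, h14, max_eq_left (not_lt.1 h)]
      obtain ⟨s2, e2, hs2⟩ := e2
      have h92 : s2.rreg 9 = max (s.rreg 9) (m (i + 1) / ((i : ℝ) + 1)) := by simp [hs2]
      refine ⟨s2, (e1.seq e2).mono (by simp), ?_, ?_, ?_, ?_, ?_, ?_, ?_, ?_, ?_, ?_, ?_, ?_⟩
      iterate 9 simp [*]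
      · rw [h92]; exact h9.trans (le_max_left _ _)
      · rintro l ⟨hl1, hl⟩
        rw [h92]
        rcases Nat.lt_or_ge i l with h | h
        · obtain rfl : l = i + 1 := by omega
          push_cast
          exact le_max_right _ _
        · exact (hle l ⟨hl1, h⟩).trans (le_max_left _ _)
      · rw [h92]
        rcases max_choice (s.rreg 9) (m (i + 1) / ((i : ℝ) + 1)) with h | h
        · rw [h]
          refine hmax.imp_right ?_
          rintro ⟨l, hl, he⟩
          exact ⟨l, ⟨hl.1, hl.2.trans (Nat.le_succ i)⟩, he⟩
        · rw [h]
          exact Or.inr ⟨i + 1, ⟨by omega, le_rfl⟩, by push_cast; rfl⟩)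
    (by
      rintro s ⟨h8, h4, -⟩
      show ¬ s.reg 8 < s.reg 4
      omega)
    (by
      obtain ⟨⟩ := hP
      refine ⟨?_, ?_, ?_, ?_, ?_, ?_, ?_, ?_, ?_, ?_, ?_, ?_⟩ <;> simp [RInstr.apply, *])
  obtain ⟨-, -, -, hA, hε, hB, hn, -, hmem, h9, hle, hmax⟩ := hI
  have e2 := Exec.block w (.rdiv 8 0 3) [.rmul 8 8 9, .rmul 7 1 4, .radd 0 8 7] s1
    (by simp [RInstr.isDet])
  refine ⟨_, (e0.seq (e1.seq e2)).mono (by simp; omega), ?_, ?_⟩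
  · simp [RInstr.apply, hmem]
  have hfin := finite_div_image m L
  have hsup : s1.rreg 9 = sSup ((fun l : ℕ => m l / l) '' Set.Icc 1 L) := by
    have hne : ((fun l : ℕ => m l / l) '' Set.Icc 1 L).Nonempty :=
      ⟨_, Set.mem_image_of_mem _ ⟨le_rfl, hL1⟩⟩
    -- The running maximum starts from `0`, which is harmless because the estimates are nonnegative.
    apply le_antisymm
    · rcases hmax with h | ⟨l, hl, h⟩
      · rw [h]
        exact (div_nonneg (hpos 1) (Nat.cast_nonneg _)).trans
          (le_csSup hfin.bddAbove (Set.mem_image_of_mem _ ⟨le_rfl, hL1⟩))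
      · rw [h]
        exact le_csSup hfin.bddAbove (Set.mem_image_of_mem _ hl)
    · refine csSup_le hne ?_
      rintro _ ⟨l, hl, rfl⟩
      exact hle l hl
  simp [RInstr.apply, lzCombine, hA, hε, hB, hn, hsup, ← hL]

/-- The contents of registers and memory after the initial computations. -/
structure Prepared (n σ : ℕ) (A ε x B : ℝ) (s : RState) : Prop where
  reg0 : s.reg 0 = n
  reg1 : s.reg 1 = σ
  reg2 : s.reg 2 = 1
  reg3 : s.reg 3 = 0
  reg5 : s.reg 5 = 0
  reg6 : s.reg 6 = 0
  mem : s.mem = fun _ => 0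
  rmem : s.rmem = fun _ => 0
  rreg0 : s.rreg 0 = A
  rreg1 : s.rreg 1 = ε
  rreg2 : s.rreg 2 = x
  rreg3 : s.rreg 3 = B
  rreg4 : s.rreg 4 = n
  rreg9 : s.rreg 9 = 0
  rreg10 : s.rreg 10 = 2
  rreg14 : s.rreg 14 = 0

theorem exec_preludeProg {σ : ℕ} (w : List (Fin σ)) (n : ℕ) (A ε : ℝ) (P : RProg) :
    ∃ s, Exec w preludeProg (P.init n σ A ε).state s 21 ∧
      Prepared n σ A ε (2 / (A * ε)) (lzB A ε) s ∧ s.rreg 5 = √(n : ℝ) ∧ s.reg 4 = 0 := by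
  have e := Exec.block w (.const 2 1) [.const 17 2, .rofNat 10 17, .rmul 2 0 1, .rdiv 2 10 2,
    .rlog 8 2, .rsqrt 8 8, .rmul 8 10 8, .rdiv 3 0 8, .rofNat 4 0, .rsqrt 5 4]
    (P.init n σ A ε).state (by simp [RInstr.isDet])
  refine ⟨_, e, ?_, ?_, ?_⟩
  · constructor <;> simp [RInstr.apply, RProg.init, lzB]
  · simp [RInstr.apply, RProg.init]
  · simp [RInstr.apply, RProg.init]

theorem exec_trivialProg {σ n : ℕ} {w : List (Fin σ)} {A ε x B : ℝ} {s : RState}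
    (hP : Prepared n σ A ε x B s) (h5 : s.rreg 5 = √(n : ℝ)) :
    ∃ s', Exec w trivialProg s s' 7 ∧ s'.rreg 0 = A / B * √(n : ℝ) + ε * n := by
  have e := Exec.block w (.rdiv 8 0 3) [.rmul 8 8 5, .rmul 7 1 4, .radd 0 8 7] s
    (by simp [RInstr.isDet])
  refine ⟨_, e, ?_⟩
  obtain ⟨⟩ := hP
  simp [RInstr.apply, *]

/-- The ceiling is found by counting upwards; the cost is linear in `ℓ₀` and is dominated by the
first insertion into the trie. -/
theorem exec_ellProg {σ n : ℕ} {w : List (Fin σ)} {A ε x B : ℝ} {s : RState}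
    (hP : Prepared n σ A ε x B s) (h4 : s.reg 4 = 0) :
    ∃ s', Exec w ellProg s s' (4 * ⌈x⌉₊ + 3) ∧ Prepared n σ A ε x B s' ∧ s'.reg 4 = ⌈x⌉₊ := by
  have e0 : Exec w (.instr (.rofNat 7 4)) s _ 1 :=
    Exec.instr (RInstr.exec_eq w s (by trivial))
  obtain ⟨s', e1, hP', h4', -⟩ := Exec.loop (w := w) (b := .rlt 7 2)
    (p := block (.add 4 4 2) [.rofNat 7 4]) (t := 3) (s := RInstr.apply w s (.rofNat 7 4))
    (fun i s => Prepared n σ A ε x B s ∧ s.reg 4 = i ∧ s.rreg 7 = i) ⌈x⌉₊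
    (by
      rintro i s hi ⟨hP, h4, h7⟩
      constructor
      · show s.rreg 7 < s.rreg 2
        rw [h7, hP.rreg2]
        exact Nat.lt_ceil.1 hi
      · refine ⟨_, Exec.block w (.add 4 4 2) [.rofNat 7 4] s (by simp [RInstr.isDet]),
          ?_, ?_, ?_⟩
        · obtain ⟨⟩ := hP
          constructor <;> simp [RInstr.apply, *]
        · simp [RInstr.apply, h4, hP.reg2]
        · simp [RInstr.apply, h4, hP.reg2])
    (by
      rintro s ⟨hP, -, h7⟩
      show ¬ s.rreg 7 < s.rreg 2
      rw [h7, hP.rreg2, not_lt]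
      exact Nat.le_ceil x)
    (by
      refine ⟨?_, ?_, ?_⟩
      · obtain ⟨⟩ := hP
        constructor <;> simp [RInstr.apply, *]
      · simp [RInstr.apply, h4]
      · simp [RInstr.apply, h4])
  exact ⟨s', (e0.seq e1).mono (by omega), hP', h4'⟩

theorem exec_boundProg {σ L : ℕ} {w : List (Fin σ)} {A ε x B : ℝ} {s : RState}
    (hP : Prepared w.length σ A ε x B s) (h4 : s.reg 4 = L) :
    ∃ s', Exec w boundProg s s' 30 ∧
      Params w.length σ L A ε B (sampleBound B w.length L) s' ∧
      HasTrie B (sampled w L ∅) s' ∧ s'.reg 5 = 0 ∧ s'.reg 6 = 0 := by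
  have e1 := Exec.block w (.rmul 11 3 3) [.rdiv 6 4 11, .radd 12 10 10, .rmul 6 6 12,
    .add 15 4 4, .add 15 15 4, .rofNat 8 15, .rlog 8 8, .rofNat 13 2, .radd 8 8 13, .rmul 6 6 8,
    .add 14 1 3] s (by simp [RInstr.isDet])
  set s1 := List.foldl (RInstr.apply w) s [.rmul 11 3 3, .rdiv 6 4 11, .radd 12 10 10,
    .rmul 6 6 12, .add 15 4 4, .add 15 15 4, .rofNat 8 15, .rlog 8 8, .rofNat 13 2,
    .radd 8 8 13, .rmul 6 6 8, .add 14 1 3] with hs1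
  have hP1 : Prepared w.length σ A ε x B s1 := by
    obtain ⟨⟩ := hP
    constructor <;> simp [RInstr.apply, *]
  have h41 : s1.reg 4 = L := by simp [RInstr.apply, hs1, h4]
  have h141 : s1.reg 14 = σ := by simp [RInstr.apply, hs1, hP.reg1, hP.reg3]
  have h11 : s1.rreg 11 = B * B := by simp [RInstr.apply, hs1, hP.rreg3]
  have h6 : s1.rreg 6 = w.length / (B * B) * 4 * (Real.logb 2 (3 * L) + 1) := by
    have e4 : (4 : ℝ) = 2 + 2 := by norm_num
    have e3 : (3 * L : ℝ) = L + L + L := by ring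
    simp [RInstr.apply, hs1, hP.rreg3, hP.rreg4, hP.rreg10, hP.reg2, h4, e4, e3]
  have htrie : ∀ s2 : RState, s2.mem = s1.mem → s2.rmem = s1.rmem → s2.reg 14 = σ →
      HasTrie B (sampled w L ∅) s2 := by
    intro s2 hm hr h14
    refine ⟨fun _ => 0, 1, ?_, by rw [h14, mul_one]⟩
    rw [hm, hr, hP1.mem, hP1.rmem]
    exact Trie.empty B
  have h10 := hP1.rreg10
  clear_value s1
  clear hs1
  obtain ⟨⟩ := hP1
  by_cases h : B * B < 2
  · have e2 := Exec.block w (.const 16 1) [.rofNat 6 0] s1 (by simp [RInstr.isDet])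
    have e2' := Exec.ite_true (b := .rlt 11 10) (q := .instr (.const 16 0))
      (show s1.rreg 11 < s1.rreg 10 by rwa [h11, h10]) e2
    refine ⟨_, (e1.seq e2').mono (by simp), ?_, htrie _ ?_ ?_ ?_, ?_, ?_⟩
    · constructor <;> simp [RInstr.apply, sampleBound, *]
    all_goals simp [RInstr.apply, *]
  · have e2 : Exec w (.instr (.const 16 0)) s1 _ 1 :=
      Exec.instr (RInstr.exec_eq w s1 (by trivial))
    have e2' := Exec.ite_false (b := .rlt 11 10) (p := block (.const 16 1) [.rofNat 6 0])
      (show ¬ s1.rreg 11 < s1.rreg 10 by rwa [h11, h10]) e2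
    refine ⟨_, (e1.seq e2').mono (by simp), ?_, htrie _ ?_ ?_ ?_, ?_, ?_⟩
    · constructor <;> simp [RInstr.apply, sampleBound, *]
    all_goals simp [RInstr.apply, *]

/-- A bound for the running time on strings of length `n`. -/
noncomputable def timeBound (A ε : ℝ) (n : ℕ) : ℕ :=
  if √(n : ℝ) < lzB A ε then 40
  else ⌈sampleBound (lzB A ε) n (lzEll A ε)⌉₊ * (31 * lzEll A ε + 23) + 50 * lzEll A ε + 100

theorem fails_lzProg_of_sqrt_lt {σ : ℕ} {w : List (Fin σ)} {A ε : ℝ}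
    (hB : √(w.length : ℝ) < lzB A ε) :
    Fails w (fun s => s.rreg 0 = A / lzB A ε * √(w.length : ℝ) + ε * w.length)
      (lzProg.init w.length σ A ε) (timeBound A ε w.length) 0 := by
  obtain ⟨s, e1, hP, h5, -⟩ := exec_preludeProg w w.length A ε lzProg
  obtain ⟨s', e2, hout⟩ := exec_trivialProg (w := w) hP h5
  refine Fails.mono (Fails.of_exec (s' := s') (k := []) (e1.seq (Exec.ite_true ?_ e2))
    (Fails.halted hout)) ?_ le_rfl
  · show s.rreg 5 < s.rreg 3
    rwa [h5, hP.rreg3]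
  · rw [timeBound, if_pos hB]
    norm_num

/-- The predicate `good` and the potential are left open: with the potential of `exists_potential`
this bounds the failure of one estimate, and with the zero potential it shows that every run halts
with the correct combination. -/
theorem fails_lzProg {σ : ℕ} {w : List (Fin σ)} {A ε : ℝ} (hw : w ≠ []) (hA : 1 < A)
    (hε : 0 < ε) (hB0 : 0 ≤ lzB A ε) (hB : lzB A ε ≤ √(w.length : ℝ))
    {good : Finset ℕ → Prop} {Φ : ℕ → Finset ℕ → ℝ} (hΦ0 : ∀ i ps, 0 ≤ Φ i ps)
    (hΦ : ∀ i ps, i < ⌈sampleBound (lzB A ε) w.length (lzEll A ε)⌉₊ →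
        (∑ j : Fin w.length, Φ (i + 1) (insert (chosen (lzB A ε) i j) ps)) / w.length ≤ Φ i ps)
    (hgood : ∀ ps, ¬ good ps →
      1 ≤ Φ ⌈sampleBound (lzB A ε) w.length (lzEll A ε)⌉₊ ps) :
    Fails w (fun s => s.rreg 0 = lzCombine A ε w.length s.rmem ∧
        ∃ ps, good ps ∧ ∀ l, s.rmem l = hits w (lzEll A ε) l ps * lzB A ε)
      (lzProg.init w.length σ A ε) (timeBound A ε w.length) (Φ 0 {0}) := by
  set N := ⌈sampleBound (lzB A ε) w.length (lzEll A ε)⌉₊ with hN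
  obtain ⟨s1, e1, hP1, h51, h41⟩ := exec_preludeProg w w.length A ε lzProg
  obtain ⟨s2, e2, hP2, h42⟩ := exec_ellProg (w := w) hP1 h41
  rw [show ⌈2 / (A * ε)⌉₊ = lzEll A ε from rfl] at e2 h42
  obtain ⟨s3, e3, hP3, hT3, h53, h63⟩ := exec_boundProg hP2 h42
  -- Register 6 is still `0`: position `0` is inserted before the sampling, which supplies the
  -- initial hit.
  obtain ⟨s4, e4, hP4, hT4, h54⟩ := exec_insertProg hP3 hT3 h63 h53
  have e5 : Exec w (.instr (.rofNat 7 5)) s4 _ 1 := Exec.instr (RInstr.exec_eq w s4 (by trivial))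
  have hend : ∀ ps s, Params w.length σ (lzEll A ε) A ε (lzB A ε)
      (sampleBound (lzB A ε) w.length (lzEll A ε)) s →
      HasTrie (lzB A ε) (sampled w (lzEll A ε) ps) s →
      Fails w (fun s => s.rreg 0 = lzCombine A ε w.length s.rmem ∧
        ∃ ps, good ps ∧ ∀ l, s.rmem l = hits w (lzEll A ε) l ps * lzB A ε)
        ⟨[outputProg], s⟩ (12 * lzEll A ε + 12) (Φ N ps) := by
    intro ps s hP hT
    by_cases hps : good ps
    · obtain ⟨id, C, hT, -⟩ := hT
      obtain ⟨s', e, hm, ho⟩ := exec_outputProg rfl (one_le_lzEll hA hε) hP fun l => by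
        rw [hT.count]; positivity
      refine (Fails.of_exec e (Fails.halted ⟨?_, ps, hps, ?_⟩)).mono (by omega) (hΦ0 _ _)
      · rw [ho, hm]
      · intro l
        rw [hm, hT.count, hits]
    · exact Fails.of_one_le (hgood ps hps)
  have hloop := fails_samplingLoop (i := 0) (ps := {0}) (s := RInstr.apply w s4 (.rofNat 7 5))
    hw hΦ0 hΦ hend (Nat.zero_le _)
    (by obtain ⟨⟩ := hP4; constructor <;> simp [RInstr.apply, *])
    (by simpa [HasTrie, RInstr.apply] using hT4) (by simp [RInstr.apply, h54])
    (by simp [RInstr.apply, h54])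
  have hmain := Fails.ite_false (b := .rlt 5 3) (p := trivialProg) (s := s1) (k := [])
    (show ¬ s1.rreg 5 < s1.rreg 3 by rw [h51, hP1.rreg3]; exact not_lt.2 hB)
    (Fails.seq (Fails.of_exec e2 (Fails.seq (Fails.of_exec e3 (Fails.seq (Fails.of_exec e4
      (Fails.seq (Fails.of_exec e5 (Fails.seq hloop)))))))))
  refine (Fails.seq (Fails.of_exec e1 hmain)).mono ?_ le_rfl
  rw [timeBound, if_neg (not_lt.2 hB), ← hN]
  simp only [Nat.sub_zero]
  omega

/-! ### Running time -/

theorem lzB_mul_self {A ε : ℝ} (hA : 1 < A) (hε : 0 < ε) (hAε : A * ε < 2) :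
    lzB A ε * lzB A ε = A ^ 2 / (4 * Real.logb 2 (2 / (A * ε))) := by
  have hlog := Real.logb_pos one_lt_two (one_lt_two_div hA hε hAε)
  rw [lzB, div_mul_div_comm, mul_mul_mul_comm, Real.mul_self_sqrt hlog.le]
  ring

theorem logb_two_le_three_mul_sqrt {x : ℝ} (hx : 0 < x) : Real.logb 2 x ≤ 3 * √x := by
  have h1 := Real.log_le_sub_one_of_pos (Real.sqrt_pos.2 hx)
  rw [Real.log_sqrt hx.le] at h1
  rw [Real.logb, div_le_iff₀ (Real.log_pos one_lt_two)]
  have h2 := Real.log_two_gt_d9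
  have := Real.sqrt_nonneg x
  nlinarith

theorem one_le_logb_two_add {g : ℝ} (hg : 0 ≤ g) : 1 ≤ Real.logb 2 (2 + g) := by
  rw [Real.le_logb_iff_rpow_le one_lt_two (by linarith), Real.rpow_one]
  linarith

/-- Bootstrapping: `log₂ x ≤ 3 √x` in the hypothesis gives `√x ≤ 24 g`, so `x` is at most quadratic
in `g` and its logarithm is of the order of `log₂ (2 + g)`. -/
theorem logb_le_of_le_mul_logb {x g : ℝ} (hx : 1 < x) (hg : 0 ≤ g)
    (h : x ≤ 8 * g * Real.logb 2 x) : Real.logb 2 x ≤ 12 * Real.logb 2 (2 + g) := by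
  have hx0 : 0 < x := by linarith
  have hs := Real.sqrt_pos.2 hx0
  have h1 : √x ≤ 24 * g := by
    have h2 := logb_two_le_three_mul_sqrt hx0
    have h3 : √x * √x ≤ 24 * g * √x := by
      rw [Real.mul_self_sqrt hx0.le]
      nlinarith
    exact le_of_mul_le_mul_right h3 hs
  -- The square of `24` is `576`, which is below `2 ^ 10`.
  have h2 : x ≤ 2 ^ (10 : ℕ) * (2 + g) ^ 2 := by
    rw [← Real.sq_sqrt hx0.le]
    nlinarith
  have h3 : Real.logb 2 x ≤ 10 + 2 * Real.logb 2 (2 + g) := by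
    refine (Real.logb_le_logb_of_le one_lt_two hx0 h2).trans (le_of_eq ?_)
    rw [Real.logb_mul (by positivity) (by positivity), Real.logb_pow, Real.logb_pow,
      Real.logb_self_eq_one one_lt_two]
    norm_num
  linarith [one_le_logb_two_add hg]

theorem timeBound_le {A ε : ℝ} {n : ℕ} (hn : 1 ≤ n) (hA : 1 < A) (hε : 0 < ε)
    (hAε : A * ε < 2) (hB : 1 < lzB A ε) :
    (timeBound A ε n : ℝ) ≤ 2000000 * max 1 (n / (A ^ 3 * ε)) *
      Real.logb 2 (2 + n / (A ^ 3 * ε)) ^ 2 := by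
  set g := (n : ℝ) / (A ^ 3 * ε) with hg
  set x := 2 / (A * ε) with hx
  set lam := Real.logb 2 x with hlam
  have hA0 : 0 < A := by linarith
  have hn' : (1 : ℝ) ≤ n := by exact_mod_cast hn
  have hg0 : 0 < g := by positivity
  have hx1 : 1 < x := one_lt_two_div hA hε hAε
  have hlam0 : 0 < lam := Real.logb_pos one_lt_two hx1
  have hl1 := one_le_logb_two_add hg0.le
  set l := Real.logb 2 (2 + g) with hl
  have hmax : 1 ≤ max 1 g := le_max_left _ _
  rw [timeBound]
  split_ifs with hlt
  · have : 1 ≤ max 1 g * l ^ 2 := one_le_mul_of_one_le_of_one_le hmax (one_le_pow₀ hl1)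
    push_cast
    linarith
  rw [not_lt] at hlt
  have hBB0 : 0 < lzB A ε * lzB A ε := by positivity
  have hBBn : lzB A ε * lzB A ε ≤ n := by
    calc _ ≤ √(n : ℝ) * √(n : ℝ) := by gcongr
      _ = n := Real.mul_self_sqrt (by positivity)
  set y := (n : ℝ) / (lzB A ε * lzB A ε) with hy
  have hy1 : 1 ≤ y := by rwa [hy, le_div_iff₀ hBB0, one_mul]
  -- The central identity: samples times length, up to logarithms, is `g`. Together with `y ≥ 1`,
  -- that is `B ≤ √n`, it also bounds `x` in terms of `g`.
  have hyx : y * x = 8 * g * lam := by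
    rw [hy, lzB_mul_self hA hε hAε, ← hx, ← hlam, hg, hx]
    field_simp
    ring
  have hlaml : lam ≤ 12 * l := by
    refine logb_le_of_le_mul_logb hx1 hg0.le ?_
    rw [← hlam, ← hyx]
    nlinarith
  have hL1 : (1 : ℝ) ≤ lzEll A ε := by exact_mod_cast one_le_lzEll hA hε
  have hL2 : (lzEll A ε : ℝ) ≤ 2 * x := by
    have : (lzEll A ε : ℝ) < x + 1 := Nat.ceil_lt_add_one (by linarith)
    linarith
  set L := lzEll A ε with hL
  have hlogL : Real.logb 2 (3 * L) ≤ 3 + lam := by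
    have h8 : Real.logb 2 (2 ^ 3 * x) = 3 + lam := by
      rw [Real.logb_mul (by positivity) (by positivity), Real.logb_pow,
        Real.logb_self_eq_one one_lt_two, ← hlam]
      norm_num
    rw [← h8]
    exact Real.logb_le_logb_of_le one_lt_two (by positivity) (by linarith)
  have hsb : sampleBound (lzB A ε) n L ≤ y * 4 * (4 + lam) := by
    rw [sampleBound]
    split_ifs with h2
    · have : (n : ℝ) = y * (lzB A ε * lzB A ε) := by rw [hy]; field_simp
      nlinarith
    · rw [← hy]
      have : Real.logb 2 (3 * L) + 1 ≤ 4 + lam := by linarith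
      gcongr
  have hsb0 : 0 ≤ sampleBound (lzB A ε) n L := by
    rw [sampleBound]
    have : 0 ≤ Real.logb 2 (3 * L) := Real.logb_nonneg one_lt_two (by linarith)
    split_ifs <;> positivity
  -- Rounding up adds at most `1 ≤ y (4 + lam)`, which turns the factor `4` into `5`.
  have hN : (⌈sampleBound (lzB A ε) n L⌉₊ : ℝ) ≤ 5 * y * (4 + lam) := by
    have := Nat.ceil_lt_add_one hsb0
    nlinarith
  have hlamg : 8 * g * lam * (4 + lam) ≤ 8 * max 1 g * (12 * l) * (16 * l) := by
    have : 4 + lam ≤ 16 * l := by linarith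
    gcongr
    exact le_max_right _ _
  push_cast
  calc (⌈sampleBound (lzB A ε) n L⌉₊ : ℝ) * (31 * L + 23) + 50 * L + 100
      ≤ 5 * y * (4 + lam) * (54 * L) + 150 * L := by
        have : (31 : ℝ) * L + 23 ≤ 54 * L := by linarith
        have : (⌈sampleBound (lzB A ε) n L⌉₊ : ℝ) * (31 * L + 23) ≤
          5 * y * (4 + lam) * (54 * L) := by gcongr
        linarith
    _ = (270 * (y * (4 + lam)) + 150) * L := by ring
    _ ≤ (270 * (y * (4 + lam)) + 150 * (y * (4 + lam))) * (2 * x) := by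
        have : 1 ≤ y * (4 + lam) := one_le_mul_of_one_le_of_one_le hy1 (by linarith)
        gcongr
        linarith
    _ = 840 * (8 * g * lam * (4 + lam)) := by rw [← hyx]; ring
    _ ≤ 840 * (8 * max 1 g * (12 * l) * (16 * l)) := by gcongr
    _ ≤ 2000000 * max 1 g * l ^ 2 := by
        have : 0 ≤ max 1 g * l ^ 2 := by positivity
        linarith

/-! ### The estimates that a run ends with -/

theorem Fails.of_mem_support {σ : ℕ} {w : List (Fin σ)} {Q : RState → Prop} {c : RConfig} {T : ℕ}
    (h : Fails w Q c T 0) : ∀ r ∈ (RConfig.run w T c).support, r.todo = [] ∧ Q r.state := by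
  intro r hr
  have h0 := h T le_rfl
  rw [ENNReal.ofReal_zero, nonpos_iff_eq_zero, PMF.toOuterMeasure_apply_eq_zero_iff] at h0
  by_contra hc
  exact Set.disjoint_left.1 h0 hr hc

theorem Fails.le_toOuterMeasure {σ : ℕ} {w : List (Fin σ)} {Q : RState → Prop} {c : RConfig}
    {T : ℕ} {δ : ℝ} (hδ : 0 ≤ δ) (h : Fails w Q c T δ) {S : Set RConfig}
    (hS : ∀ r : RConfig, Q r.state → r ∈ S) :
    ENNReal.ofReal (1 - δ) ≤ (RConfig.run w T c).toOuterMeasure S := by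
  set p := RConfig.run w T c
  have h1 : (1 : ℝ≥0∞) ≤ p.toOuterMeasure S +
      p.toOuterMeasure {r | ¬ (r.todo = [] ∧ Q r.state)} := by
    calc (1 : ℝ≥0∞) = p.toOuterMeasure Set.univ :=
          ((PMF.toOuterMeasure_apply_eq_one_iff _ _).2 (Set.subset_univ _)).symm
      _ ≤ p.toOuterMeasure (S ∪ {r | ¬ (r.todo = [] ∧ Q r.state)}) := by
          refine p.toOuterMeasure.mono fun r _ => ?_
          by_cases hr : r.todo = [] ∧ Q r.state
          · exact Or.inl (hS r hr.2)
          · exact Or.inr hr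
      _ ≤ _ := MeasureTheory.measure_union_le _ _
  rw [ENNReal.ofReal_sub _ hδ, ENNReal.ofReal_one, tsub_le_iff_right]
  exact h1.trans (add_le_add le_rfl (h T le_rfl))

/-- Since `1 ≤ d_l ≤ n` for `l ≤ n`, the geometric mean `√n` of the two bounds is off by a factor of
at most `√n < B`. -/
theorem isMulEstimate_trivial {α : Type*} [DecidableEq α] {w : List α} {B : ℝ} (hB : 1 < B)
    (h : √(w.length : ℝ) < B) {l : ℕ} (hl : 1 ≤ l) :
    IsMulEstimate B (numSubstrings w l) (if l ≤ w.length then √(w.length : ℝ) else 0) := by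
  have hB0 : 0 < B := by linarith
  split_ifs with hlw
  · have h1 : (1 : ℝ) ≤ numSubstrings w l := by exact_mod_cast one_le_numSubstrings w hlw
    have h2 : (numSubstrings w l : ℝ) ≤ w.length := by
      exact_mod_cast numSubstrings_le_length w hl
    constructor
    · rw [div_le_iff₀ hB0]
      have := Real.mul_self_sqrt (Nat.cast_nonneg (α := ℝ) w.length)
      have := Real.sqrt_nonneg (w.length : ℝ)
      nlinarith
    · nlinarith
  · rw [numSubstrings_eq_zero w (by omega)]
    simp [IsMulEstimate]

theorem lzCombine_trivial {A ε : ℝ} {n : ℕ} (hn : 1 ≤ n) (hA : 1 < A) (hε : 0 < ε) :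
    lzCombine A ε n (fun l => if l ≤ n then √(n : ℝ) else 0) =
      A / lzB A ε * √(n : ℝ) + ε * n := by
  have hsup : IsGreatest ((fun l : ℕ => (if l ≤ n then √(n : ℝ) else 0) / l) ''
      Set.Icc 1 (lzEll A ε)) √(n : ℝ) := by
    constructor
    · exact ⟨1, ⟨le_rfl, one_le_lzEll hA hε⟩, by simp [hn]⟩
    · rintro _ ⟨l, hl, rfl⟩
      have hl1 : (1 : ℝ) ≤ l := by exact_mod_cast hl.1
      have := Real.sqrt_nonneg (n : ℝ)
      dsimp only
      split_ifs
      · exact div_le_self this hl1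
      · simp
  rw [lzCombine, hsup.csSup_eq]

theorem lzProg_output {σ : ℕ} {w : List (Fin σ)} {A ε : ℝ} (hw : w ≠ []) (hA : 1 < A)
    (hε : 0 < ε) (hB : 1 < lzB A ε) :
    ∀ r ∈ (lzProg.result w A ε (timeBound A ε w.length)).support, r.todo = [] ∧
      r.state.queries ≤ timeBound A ε w.length ∧
      r.state.rreg 0 = lzCombine A ε w.length (r.state.dhat w.length (lzB A ε)) := by
  intro r hr
  have hq := queries_le_of_mem_support w _ _ r hr
  simp only [RProg.init, zero_add] at hq
  rcases le_or_gt (lzB A ε) √(w.length : ℝ) with h | h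
  -- With every sample set declared good, the zero potential is admissible; failure probability `0`
  -- is a statement about the whole support.
  · obtain ⟨h1, h2, -⟩ := (fails_lzProg (good := fun _ => True) (Φ := fun _ _ => 0) hw hA hε
      (by linarith) h (by simp) (by simp) (by simp)).of_mem_support r hr
    have hd : r.state.dhat w.length (lzB A ε) = r.state.rmem := by
      funext l; rw [RState.dhat, if_pos h]
    exact ⟨h1, hq, by rw [h2, hd]⟩
  · obtain ⟨h1, h2⟩ := (fails_lzProg_of_sqrt_lt h).of_mem_support r hr
    have hd : r.state.dhat w.length (lzB A ε) =
        fun l => if l ≤ w.length then √(w.length : ℝ) else 0 := by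
      funext l; rw [RState.dhat, if_neg (not_le.2 h)]
    exact ⟨h1, hq, by rw [h2, hd, lzCombine_trivial (List.length_pos_of_ne_nil hw) hA hε]⟩

theorem lzProg_estimates {σ : ℕ} {w : List (Fin σ)} {A ε : ℝ} (hw : w ≠ []) (hA : 1 < A)
    (hε : 0 < ε) (hB : 1 < lzB A ε) {l : ℕ} (hl : l ∈ Set.Icc 1 (lzEll A ε)) :
    ENNReal.ofReal (1 - 1 / (3 * (lzEll A ε : ℝ))) ≤
      (lzProg.result w A ε (timeBound A ε w.length)).toOuterMeasure
        {r | IsMulEstimate (lzB A ε) (numSubstrings w l)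
          (r.state.dhat w.length (lzB A ε) l)} := by
  have hδ : 0 ≤ 1 / (3 * (lzEll A ε : ℝ)) := by positivity
  rcases le_or_gt (lzB A ε) √(w.length : ℝ) with h | h
  · obtain ⟨Φ, hΦ0, hΦ, hgood, hstart⟩ := exists_potential hw hl.1 hl.2 hB
    refine Fails.le_toOuterMeasure hδ ((fails_lzProg hw hA hε (by linarith) h hΦ0 hΦ
      hgood).mono le_rfl hstart) ?_
    rintro r ⟨-, ps, hps, hmem⟩
    rw [Set.mem_ofPred_eq, RState.dhat, if_pos h, hmem]
    exact hps
  · refine Fails.le_toOuterMeasure hδ ((fails_lzProg_of_sqrt_lt h).mono le_rfl hδ) ?_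
    intro r _
    rw [Set.mem_ofPred_eq, RState.dhat, if_neg (not_le.2 h)]
    exact isMulEstimate_trivial hB h hl.1

theorem two_thirds_le_toOuterMeasure {σ : ℕ} {w : List (Fin σ)} {A ε : ℝ} (hw : w ≠ [])
    (hA : 1 < A) (hε : 0 < ε) (hAε : A * ε < 2) (hB : 1 < lzB A ε) (p : PMF RConfig)
    (hout : ∀ r ∈ p.support,
      r.state.rreg 0 = lzCombine A ε w.length (r.state.dhat w.length (lzB A ε)))
    (hest : ∀ l ∈ Set.Icc 1 (lzEll A ε), ENNReal.ofReal (1 - 1 / (3 * (lzEll A ε : ℝ))) ≤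
      p.toOuterMeasure {r | IsMulEstimate (lzB A ε) (numSubstrings w l)
        (r.state.dhat w.length (lzB A ε) l)}) :
    2 / 3 ≤ p.toOuterMeasure {r | IsEstimate A ε w.length (lzCost w) (r.state.rreg 0)} := by
  -- With all sets measurable, the first part of the theorem applies to the final configurations as
  -- probability space.
  let _ : MeasurableSpace RConfig := ⊤
  have htop : ∀ S : Set RConfig, p.toMeasure S = p.toOuterMeasure S := fun S =>
    PMF.toMeasure_apply_eq_toOuterMeasure_apply p trivial
  have h := isEstimate_lzCombine_of_probability hw hA hε hAε hB p.toMeasure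
    (fun r => r.state.dhat w.length (lzB A ε)) (fun l _ => measurable_from_top) fun l hl => by
      rw [MeasureTheory.measureReal_def, ← ENNReal.ofReal_le_iff_le_toReal
        (MeasureTheory.measure_ne_top _ _), htop]
      exact hest l hl
  rw [MeasureTheory.measureReal_def, ← ENNReal.ofReal_le_iff_le_toReal
    (MeasureTheory.measure_ne_top _ _), htop] at h
  have h23 : ENNReal.ofReal (2 / 3) = 2 / 3 := by
    rw [ENNReal.ofReal_div_of_pos (by norm_num)]; norm_num
  rw [h23] at h
  refine h.trans (PMF.toOuterMeasure_mono p ?_)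
  rintro r ⟨hr, hs⟩
  rw [Set.mem_ofPred_eq, hout r hs]
  exact hr

theorem mainTheorem1 :
    -- Correctness of the algorithm with an arbitrary procedure that estimates the numbers `d_ℓ`:
    -- the estimates are random variables with an arbitrary joint distribution.
    (∀ (σ : ℕ) (w : List (Fin σ)) (A ε : ℝ),
      w ≠ [] → 1 < A → 0 < ε → A * ε < 2 → 1 < lzB A ε →
      ∀ (Ω : Type) [MeasurableSpace Ω] (μ : MeasureTheory.Measure Ω)
        [MeasureTheory.IsProbabilityMeasure μ] (dhat : Ω → ℕ → ℝ),
        (∀ l ∈ Set.Icc 1 (lzEll A ε), Measurable fun ω => dhat ω l) →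
        (∀ l ∈ Set.Icc 1 (lzEll A ε),
          1 - 1 / (3 * (lzEll A ε : ℝ)) ≤
            μ.real {ω | IsMulEstimate (lzB A ε) (numSubstrings w l) (dhat ω l)}) →
        2 / 3 ≤ μ.real {ω | IsEstimate A ε w.length (lzCost w)
          (lzCombine A ε w.length (dhat ω))}) ∧
    -- An implementation with the claimed query and time complexity.
    (∃ (P : RProg) (K : ℝ) (c : ℕ),
      ∀ (σ : ℕ) (w : List (Fin σ)) (A ε : ℝ),
        w ≠ [] → 1 < A → 0 < ε → A * ε < 2 → 1 < lzB A ε →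
        ∃ T : ℕ,
          (T : ℝ) ≤ K * max 1 (w.length / (A ^ 3 * ε)) *
            Real.logb 2 (2 + w.length / (A ^ 3 * ε)) ^ c ∧
          -- every run halts within `T` steps, makes at most `T` queries,
          -- and outputs the value that the algorithm computes from its estimates
          (∀ r ∈ (P.result w A ε T).support,
            r.todo = [] ∧ r.state.queries ≤ T ∧
            r.state.rreg 0 =
              lzCombine A ε w.length (r.state.dhat w.length (lzB A ε))) ∧
          -- each estimate has the required quality and confidence
          (∀ l ∈ Set.Icc 1 (lzEll A ε),
            ENNReal.ofReal (1 - 1 / (3 * (lzEll A ε : ℝ))) ≤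
              (P.result w A ε T).toOuterMeasure
                {r | IsMulEstimate (lzB A ε) (numSubstrings w l)
                  (r.state.dhat w.length (lzB A ε) l)}) ∧
          -- the output is an `(A, ε)`-estimate of the compression cost
          2 / 3 ≤ (P.result w A ε T).toOuterMeasure
            {r | IsEstimate A ε w.length (lzCost w) (r.state.rreg 0)}) := by
  refine ⟨?_, lzProg, 2000000, 2, ?_⟩
  · intro σ w A ε hw hA hε hAε hB Ω _ μ _ dhat hmeas hprob
    exact isEstimate_lzCombine_of_probability hw hA hε hAε hB μ dhat hmeas hprob
  · intro σ w A ε hw hA hε hAε hB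
    have hout := lzProg_output hw hA hε hB
    have hest := fun l hl => lzProg_estimates (l := l) hw hA hε hB hl
    exact ⟨timeBound A ε w.length,
      timeBound_le (List.length_pos_of_ne_nil hw) hA hε hAε hB, hout, hest,
      two_thirds_le_toOuterMeasure hw hA hε hAε hB _ (fun r hr => (hout r hr).2.2) hest⟩
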